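/- Let $G=(I,A)$ be a finite directed acyclic multigraph with distinct nodes $o$ (origin) and $d$ (destination) such that every node lies on a directed path from $o$ to $d$, together with a map $a\mapsto[a]$ assigning to each arc of $G$ the arc of an original network of which it is a copy (for instance, any condensed DAG (CoDAG) representation of a single-origin single-destination traffic network). For an arc $a$ let $i_a,j_a$ be its start and end node, and for a node $i$ let $A_i^-,A_i^+$ be its sets of incoming and outgoing arcs. Each original arc $e$ has a latency function $s_e:[0,\infty)\to[0,\infty)$ that is continuous and strictly increasing. Let $\beta>0$ and $g_o>0$, and put $g_i=g_o$ if $i=o$ and $g_i=0$ otherwise. Let $$\mathcal W=\Big\{w\in\mathbb R^{A}:\ \sum_{a\in A_i^+}w_a=\sum_{a\in A_i^-}w_a\ \ \forall i\neq o,d,\quad \sum_{a\in A_o^+}w_a=g_o,\quad w_a\ge 0\ \ \forall a\in A\Big\}.$$ For $w\in\mathcal W$ put $w_{[a]}=\sum_{a':[a']=[a]}w_{a'}$, and define the latencies-to-go $z_a(w)$ recursively, backwards from $d$, by $z_a(w)=s_{[a]}(w_{[a]})$ if $j_a=d$ and $$z_a(w)=s_{[a]}(w_{[a]})-\frac1\beta\ln\Big(\sum_{a'\in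 A_{j_a}^+}e^{-\beta z_{a'}(w)}\Big)\quad\text{if } j_a\ne d,$$ and the choice probabilities $P_a(w)=e^{-\beta z_a(w)}\big/\sum_{a'\in A_{i_a}^+}e^{-\beta z_{a'}(w)}$. A CoDAG equilibrium is a $w\in\mathcal W$ such that $w_a=\big(g_{i_a}+\sum_{a'\in A_{i_a}^-}w_{a'}\big)P_a(w)$ for every $a\in A$. Given update rates $K_i>0$ ($i\neq d$), a trajectory is a pair $(\xi(t),w(t))_{t\ge0}$ such that, for all $a\in A$ and $t\ge0$, $$\dot\xi_a(t)=K_{i_a}\big(-\xi_a(t)+P_a(w(t))\big),\qquad w_a(t)=\Big(g_{i_a}+\sum_{a'\in A_{i_a}^-}w_{a'}(t)\Big)\xi_a(t),$$ with $w(0)\in\mathcal W$ and $\xi_a(0)>0$ for all $a$. For a set $S$ of initial flows, call $C_w>0$ a flow bound for $S$ if, for all positive update rates and all trajectories with $w(0)\in S$, one has $w_a(t)\in[C_w,g_o]$ for all $a\in A$, $t\ge0$. Then there is a unique CoDAG equilibrium $\bar w^\beta$, and the following hold. 1. If there is $\delta>0$ with $w_a\ge\delta$ for all $w\in S$ and $a\in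 A$ (for example if $S$ consists of a single flow with positive components), then a flow bound $C_w$ for $S$ exists; by definition it does not depend on the update rates. 2. Let $C_w$ be any flow bound for $S$, and let the update rates $K_i>0$ satisfy $$K_i>\frac{g_o}{C_w}\max\{K_{i_{\hat a}}:\hat a\in A_i^-\}\qquad\text{for every } i\in I\setminus\{d\}$$ (no condition if $A_i^-=\emptyset$). Then the dynamics converge globally asymptotically on $S$ to $\bar w^\beta$: every trajectory with $w(0)\in S$ satisfies $w(t)\to\bar w^\beta$ as $t\to\infty$, and $\bar w^\beta$ is Lyapunov stable along these trajectories, i.e. for every $\varepsilon>0$ there is $\delta>0$ such that every trajectory with $w(0)\in S$ and $\|w(0)-\bar w^\beta\|<\delta$ satisfies $\|w(t)-\bar w^\beta\|<\varepsilon$ for all $t\ge0$. -/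

import Mathlib

open Filter Topology

/-- A single-origin single-destination network: a finite directed acyclic multigraph with node type
`I` and arc type `A`, in which every node lies on a route from the origin `o` to the destination `d`
(so no arc enters `o`, no arc leaves `d`, and `I` is finite as `A` is).
The map `lab` sends an arc to the arc `[a]` of the underlying original network of which it is a copy;
several arcs may be copies of the same original arc.
Every condensed DAG representation of a traffic network is such a network. -/
structure CoDAG (I A AO : Type*) where
  src : A → I
  tgt : A → I
  o : I
  d : I
  lab : A → AO
  o_ne_d : o ≠ d
  acyclic : ∀ i, ¬ Relation.TransGen (fun i j => ∃ a, src a = i ∧ tgt a = j) i i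
  reach_from_o : ∀ i, Relation.ReflTransGen (fun i j => ∃ a, src a = i ∧ tgt a = j) o i
  reach_to_d : ∀ i, Relation.ReflTransGen (fun i j => ∃ a, src a = i ∧ tgt a = j) i d

namespace CoDAG

variable {I A AO : Type*} [Fintype A]

/-- In a finite acyclic graph, the relation "`a'` directly follows `a`" can be recursed on. -/
theorem wellFounded_follows (N : CoDAG I A AO) :
    WellFounded (fun a' a : A => N.src a' = N.tgt a) := by
  classical
  have key : ∀ a' a : A, Relation.TransGen (fun a' a : A => N.src a' = N.tgt a) a' a →
      Relation.TransGen (fun i j => ∃ a, N.src a = i ∧ N.tgt a = j) (N.src a) (N.src a') := by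
    intro a' a h
    induction h with
    | single h => exact .single ⟨_, rfl, h.symm⟩
    | tail _ h ih => exact .head ⟨_, rfl, h.symm⟩ ih
  have hirr : Std.Irrefl (Relation.TransGen (fun a' a : A => N.src a' = N.tgt a)) :=
    ⟨fun a h => N.acyclic _ (key a a h)⟩
  have hwf : WellFounded (Relation.TransGen (fun a' a : A => N.src a' = N.tgt a)) :=
    Finite.wellFounded_of_trans_of_irrefl _
  exact hwf.mono fun _ _ h => Relation.TransGen.single h

variable [DecidableEq I] [DecidableEq AO]

/-- The total flow `w_[a]` on the original arc of which `a` is a copy. -/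
def origFlow (N : CoDAG I A AO) (w : A → ℝ) (a : A) : ℝ :=
  ∑ a' with N.lab a' = N.lab a, w a'

/-- The flow entering node `i`: `g_i + ∑_{a ∈ A_i^-} w_a`, with `g_i = g` at the origin
and `g_i = 0` elsewhere. -/
def inflow (N : CoDAG I A AO) (g : ℝ) (w : A → ℝ) (i : I) : ℝ :=
  (if i = N.o then g else 0) + ∑ a with N.tgt a = i, w a

/-- The flow leaving node `i`: `∑_{a ∈ A_i^+} w_a`. -/
def outflow (N : CoDAG I A AO) (w : A → ℝ) (i : I) : ℝ :=
  ∑ a with N.src a = i, w a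

/-- The set `𝒲` of feasible arc flows for the demand `g`. -/
def feasible (N : CoDAG I A AO) (g : ℝ) : Set (A → ℝ) :=
  {w | (∀ i, i ≠ N.o → i ≠ N.d → N.outflow w i = ∑ a with N.tgt a = i, w a) ∧
    N.outflow w N.o = g ∧ ∀ a, 0 ≤ w a}

/-- The expected latency-to-go `z_a(w)`, by recursion from the destination backwards;
its defining equation is `costToGo_eq` below. -/
noncomputable def costToGo (N : CoDAG I A AO) (s : AO → ℝ → ℝ) (β : ℝ) (w : A → ℝ) : A → ℝ :=
  N.wellFounded_follows.fix fun a z =>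
    if N.tgt a = N.d then s (N.lab a) (N.origFlow w a)
    else s (N.lab a) (N.origFlow w a) -
      1 / β * Real.log (∑ a' : {a' // N.src a' = N.tgt a}, Real.exp (-β * z a'.1 a'.2))

theorem costToGo_eq (N : CoDAG I A AO) (s : AO → ℝ → ℝ) (β : ℝ) (w : A → ℝ) (a : A) :
    N.costToGo s β w a =
      if N.tgt a = N.d then s (N.lab a) (N.origFlow w a)
      else s (N.lab a) (N.origFlow w a) -
        1 / β * Real.log (∑ a' with N.src a' = N.tgt a, Real.exp (-β * N.costToGo s β w a')) := by
  rw [costToGo, WellFounded.fix_eq]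
  congr 4
  exact (Finset.sum_subtype _ (by simp)
    (fun a' => Real.exp (-β * N.costToGo s β w a'))).symm

/-- The logit (softmax) probability of choosing arc `a` at its start node, given the flow `w`. -/
noncomputable def choiceProb (N : CoDAG I A AO) (s : AO → ℝ → ℝ) (β : ℝ) (w : A → ℝ) (a : A) : ℝ :=
  Real.exp (-β * N.costToGo s β w a) /
    ∑ a' with N.src a' = N.src a, Real.exp (-β * N.costToGo s β w a')

/-- `w` is a condensed DAG equilibrium. -/
def IsEquilibrium (N : CoDAG I A AO) (s : AO → ℝ → ℝ) (β g : ℝ) (w : A → ℝ) : Prop :=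
  w ∈ N.feasible g ∧ ∀ a, w a = N.inflow g w (N.src a) * N.choiceProb s β w a

/-- `(ξ, w)` is a solution on `[0, ∞)` of the continuous-time perturbed best response dynamics with
node update rates `K`: `ξ` are the arc selection probabilities and `w` is the arc flow they induce.
The initial flow is feasible and every arc is initially selected with positive probability. -/
structure IsTrajectory (N : CoDAG I A AO) (s : AO → ℝ → ℝ) (β g : ℝ) (K : I → ℝ)
    (ξ w : ℝ → A → ℝ) : Prop where
  selection : ∀ t, 0 ≤ t → ∀ a, HasDerivWithinAt (fun τ => ξ τ a)
    (K (N.src a) * (-ξ t a + N.choiceProb s β (w t) a)) (Set.Ici 0) t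
  flow : ∀ t, 0 ≤ t → ∀ a, w t a = N.inflow g (w t) (N.src a) * ξ t a
  init_feasible : w 0 ∈ N.feasible g
  init_pos : ∀ a, 0 < ξ 0 a

/-- `C > 0` is a lower bound (the constant `C_w`) for the arc flows along all trajectories
whose initial flow is in `S`, for all positive update rates `K`: these flows stay in `[C, g]`. -/
def IsFlowBound (N : CoDAG I A AO) (s : AO → ℝ → ℝ) (β g : ℝ) (S : Set (A → ℝ)) (C : ℝ) : Prop :=
  0 < C ∧ ∀ K : I → ℝ, (∀ i, i ≠ N.d → 0 < K i) → ∀ ξ w : ℝ → A → ℝ,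
    N.IsTrajectory s β g K ξ w → w 0 ∈ S → ∀ t, 0 ≤ t → ∀ a, w t a ∈ Set.Icc C g

end CoDAG

/-! ### Flows on a finite DAG: conservation, splitting ratios, bounds. -/

namespace CoDAG

variable {I A AO : Type*}

/-! Write x_i for the flow through node i, ξ_a = w_a / x_i for the splitting ratio at i = i_a, P for
the choice probabilities, and F(w) = ∑_e ∫_0^{w_e} s_e + (1/β) ∑_a w_a ln ξ_a. By the logit
recursion, s_[a] is a difference of node costs minus (1/β) ln P_a. Node costs telescope to zero
along a conserved direction u of zero demand, so dF(w)·u = (1/β) ∑ u_a ln(ξ_a / P_a)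
(`sum_mul_gradient`). Critical points are thus the flows with ξ = P, the equilibria.

The Bregman divergence of the entropy term is a sum of relative entropies of splitting ratios,
weighted by node flows. It vanishes only when the ratios agree, and ratios determine the flow. So an
equilibrium is the strict minimizer of F among positive feasible flows
(`IsEquilibrium.potential_lt`), which gives uniqueness. Existence comes from minimizing F over a
compact set of positive flows that contains the flow split according to P.

Along the dynamics, w'_a = x'_i ξ_a + K_i x_i (P_a - ξ_a), hence β F' = -∑ (K_i x_i - x'_i) ξ_a
ln(ξ_a / P_a) - ∑ K_i x_i P_a ln(P_a / ξ_a). The second sum is β times the dissipation. The first is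
nonnegative once x'_i ≤ K_i x_i, and this is where the rate condition enters
(`inflow_le_of_growth`). So F is a Lyapunov function (`IsTrajectory.exists_potential_deriv`). Since
trajectories stay in the compact set of feasible flows with all components at least C, compactness
turns decay of F into convergence and stability. -/

theorem src_ne_d (N : CoDAG I A AO) (a : A) : N.src a ≠ N.d := fun h =>
  N.acyclic N.d (.head' ⟨a, h, rfl⟩ (N.reach_to_d _))

theorem tgt_ne_o (N : CoDAG I A AO) (a : A) : N.tgt a ≠ N.o := fun h =>
  N.acyclic N.o (.tail' (N.reach_from_o _) ⟨a, rfl, h⟩)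

theorem exists_tgt_eq (N : CoDAG I A AO) {i : I} (hi : i ≠ N.o) : ∃ a, N.tgt a = i := by
  rcases (N.reach_from_o i).cases_tail with h | ⟨_, _, a, _, h⟩
  · exact absurd h hi
  · exact ⟨a, h⟩

theorem exists_src_eq (N : CoDAG I A AO) {i : I} (hi : i ≠ N.d) : ∃ a, N.src a = i := by
  rcases (N.reach_to_d i).cases_head with h | ⟨_, ⟨a, h, _⟩, _⟩
  · exact absurd h hi
  · exact ⟨a, h⟩

theorem nonempty_arc (N : CoDAG I A AO) : Nonempty A :=
  let ⟨a, _⟩ := N.exists_src_eq N.o_ne_d; ⟨a⟩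

/-- The relation "`a'` directly precedes `a`" can be recursed on. -/
theorem wellFounded_precedes [Finite A] (N : CoDAG I A AO) :
    WellFounded (fun a' a : A => N.tgt a' = N.src a) := by
  have key : ∀ a' a : A, Relation.TransGen (fun a' a : A => N.tgt a' = N.src a) a' a →
      Relation.TransGen (fun i j => ∃ a, N.src a = i ∧ N.tgt a = j) (N.src a') (N.src a) := by
    intro a' a h
    induction h with
    | single h => exact .single ⟨_, rfl, h⟩
    | tail _ h ih => exact .tail ih ⟨_, rfl, h⟩
  have hirr : Std.Irrefl (Relation.TransGen (fun a' a : A => N.tgt a' = N.src a)) :=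
    ⟨fun a h => N.acyclic _ (key a a h)⟩
  have hwf : WellFounded (Relation.TransGen (fun a' a : A => N.tgt a' = N.src a)) :=
    Finite.wellFounded_of_trans_of_irrefl _
  exact hwf.mono fun _ _ h => Relation.TransGen.single h

variable [Fintype A] [DecidableEq I]

theorem inflow_zero (N : CoDAG I A AO) (u : A → ℝ) (i : I) :
    N.inflow 0 u i = ∑ a with N.tgt a = i, u a := by
  simp [inflow]

theorem inflow_origin (N : CoDAG I A AO) (g : ℝ) (u : A → ℝ) : N.inflow g u N.o = g := by
  have : (Finset.univ.filter fun a => N.tgt a = N.o) = ∅ :=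
    Finset.filter_eq_empty_iff.2 fun a _ => N.tgt_ne_o a
  simp [inflow, this]

theorem mem_feasible_iff (N : CoDAG I A AO) {g : ℝ} {w : A → ℝ} :
    w ∈ N.feasible g ↔ (∀ i, i ≠ N.d → N.outflow w i = N.inflow g w i) ∧ ∀ a, 0 ≤ w a := by
  constructor
  · rintro ⟨h1, h2, h3⟩
    refine ⟨fun i hi => ?_, h3⟩
    by_cases ho : i = N.o
    · rw [ho, h2, inflow_origin]
    · rw [h1 i ho hi, inflow, if_neg ho, zero_add]
  · rintro ⟨h1, h3⟩
    refine ⟨fun i ho hi => ?_, ?_, h3⟩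
    · rw [h1 i hi, inflow, if_neg ho, zero_add]
    · rw [h1 _ N.o_ne_d, inflow_origin]

theorem sum_src_mul (N : CoDAG I A AO) (U : Finset I) (hU : ∀ a, N.src a ∈ U) (f : I → ℝ)
    (p : A → ℝ) : ∑ a, f (N.src a) * p a = ∑ i ∈ U, f i * N.outflow p i := by
  rw [← Finset.sum_fiberwise_of_maps_to (g := N.src) (t := U) (fun a _ => hU a)]
  refine Finset.sum_congr rfl fun i _ => ?_
  rw [outflow, Finset.mul_sum]
  exact Finset.sum_congr rfl fun a ha => by rw [(Finset.mem_filter.1 ha).2]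

theorem sum_src_mul_congr (N : CoDAG I A AO) (f : I → ℝ) {p q : A → ℝ}
    (h : ∀ i, i ≠ N.d → N.outflow p i = N.outflow q i) :
    ∑ a, f (N.src a) * p a = ∑ a, f (N.src a) * q a := by
  have hU : ∀ a, N.src a ∈ Finset.univ.image N.src := fun a =>
    Finset.mem_image_of_mem _ (Finset.mem_univ a)
  rw [N.sum_src_mul _ hU, N.sum_src_mul _ hU]
  refine Finset.sum_congr rfl fun i hi => ?_
  obtain ⟨a, _, rfl⟩ := Finset.mem_image.1 hi
  rw [h _ (N.src_ne_d a)]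

/-- Summation by parts for a conserved flow and a node potential vanishing at the destination. -/
theorem sum_mul_potential_diff (N : CoDAG I A AO) {g : ℝ} {u : A → ℝ}
    (hu : ∀ i, i ≠ N.d → N.outflow u i = N.inflow g u i) (φ : I → ℝ) (hφ : φ N.d = 0) :
    ∑ a, u a * (φ (N.src a) - φ (N.tgt a)) = g * φ N.o := by
  -- `I` carries no `Fintype` instance, so node sums run over a finite set holding the origin and
  -- all arc endpoints.
  set U : Finset I := insert N.o (Finset.univ.image N.src ∪ Finset.univ.image N.tgt) with hUdef
  have h1 : ∑ a, φ (N.src a) * u a = ∑ i ∈ U, φ i * N.outflow u i :=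
    N.sum_src_mul U (fun a => by simp [hUdef]) φ u
  have h2 : ∑ a, φ (N.tgt a) * u a = ∑ i ∈ U, φ i * ∑ a with N.tgt a = i, u a := by
    rw [← Finset.sum_fiberwise_of_maps_to (g := N.tgt) (t := U) (fun a _ => by simp [hUdef])]
    refine Finset.sum_congr rfl fun i _ => ?_
    rw [Finset.mul_sum]
    exact Finset.sum_congr rfl fun a ha => by rw [(Finset.mem_filter.1 ha).2]
  have h3 : ∀ i ∈ U, φ i * N.outflow u i - φ i * ∑ a with N.tgt a = i, u a
      = if i = N.o then g * φ N.o else 0 := by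
    intro i _
    by_cases hd : i = N.d
    · rw [hd, hφ, if_neg N.o_ne_d.symm]; ring
    · rw [hu i hd, inflow]
      split_ifs with ho
      · rw [ho]; ring
      · ring
  calc ∑ a, u a * (φ (N.src a) - φ (N.tgt a))
      = ∑ a, φ (N.src a) * u a - ∑ a, φ (N.tgt a) * u a := by
        rw [← Finset.sum_sub_distrib]; exact Finset.sum_congr rfl fun a _ => by ring
    _ = g * φ N.o := by
        rw [h1, h2, ← Finset.sum_sub_distrib, Finset.sum_congr rfl h3, Finset.sum_ite_eq' U,
          if_pos (Finset.mem_insert_self _ _)]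

/-- A cut argument: sum by parts against the indicator of the nodes from which `i` is reachable.
Every arc contributes a nonnegative term, and arcs leaving `i` contribute their full flow by
acyclicity, while the total is `g`. -/
theorem outflow_le (N : CoDAG I A AO) {g : ℝ} {w : A → ℝ} (hw : w ∈ N.feasible g) {i : I}
    (hi : i ≠ N.d) : N.outflow w i ≤ g := by
  classical
  obtain ⟨h1, h2⟩ := N.mem_feasible_iff.1 hw
  let R : I → I → Prop := fun i j => ∃ a, N.src a = i ∧ N.tgt a = j
  let φ : I → ℝ := fun j => if Relation.ReflTransGen R j i then 1 else 0
  have hφd : φ N.d = 0 := by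
    refine if_neg fun h => ?_
    rcases h.cases_head with h | ⟨_, ⟨a, h, _⟩, _⟩
    · exact hi h.symm
    · exact N.src_ne_d a h
  have hφo : φ N.o = 1 := if_pos (N.reach_from_o i)
  have key := N.sum_mul_potential_diff h1 φ hφd
  rw [hφo, mul_one] at key
  rw [← key, outflow, Finset.sum_filter]
  refine Finset.sum_le_sum fun a _ => ?_
  by_cases hs : Relation.ReflTransGen R (N.src a) i
  · have hs1 : φ (N.src a) = 1 := if_pos hs
    split_ifs with hai
    · have : φ (N.tgt a) = 0 := by
        refine if_neg fun h => N.acyclic i (.head' ⟨a, hai, rfl⟩ h)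
      rw [hs1, this]; simp
    · have : φ (N.tgt a) ≤ 1 := by
        show (if _ then (1 : ℝ) else 0) ≤ 1
        split_ifs <;> norm_num
      rw [hs1]
      exact mul_nonneg (h2 a) (by linarith)
  · have hs0 : φ (N.src a) = 0 := if_neg hs
    have ht0 : φ (N.tgt a) = 0 := if_neg fun h => hs (.head ⟨a, rfl, rfl⟩ h)
    rw [if_neg (fun h : N.src a = i => hs (by rw [h])), hs0, ht0]
    simp

theorem le_outflow (N : CoDAG I A AO) {w : A → ℝ} (hw : ∀ a, 0 ≤ w a) (a : A) :
    w a ≤ N.outflow w (N.src a) :=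
  Finset.single_le_sum (f := w) (fun b _ => hw b) (by simp)

theorem le_demand (N : CoDAG I A AO) {g : ℝ} {w : A → ℝ} (hw : w ∈ N.feasible g) (a : A) :
    w a ≤ g :=
  (N.le_outflow hw.2.2 a).trans (N.outflow_le hw (N.src_ne_d a))

theorem inflow_congr (N : CoDAG I A AO) {g : ℝ} {v w : A → ℝ} {i : I}
    (h : ∀ a, N.tgt a = i → v a = w a) : N.inflow g v i = N.inflow g w i := by
  rw [inflow, inflow, Finset.sum_congr rfl fun a ha => h a (Finset.mem_filter.1 ha).2]

/-- Arc flows are determined by the splitting ratios at the nodes. -/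
theorem eq_of_split (N : CoDAG I A AO) {g : ℝ} {ξ v w : A → ℝ}
    (hv : ∀ a, v a = N.inflow g v (N.src a) * ξ a)
    (hw : ∀ a, w a = N.inflow g w (N.src a) * ξ a) : v = w := by
  funext a
  induction a using N.wellFounded_precedes.induction with
  | _ a ih => rw [hv, hw, N.inflow_congr ih]

theorem exists_split (N : CoDAG I A AO) (g : ℝ) (ξ : A → ℝ) :
    ∃ w : A → ℝ, ∀ a, w a = N.inflow g w (N.src a) * ξ a := by
  let w : A → ℝ := N.wellFounded_precedes.fix fun a z =>
    ((if N.src a = N.o then g else 0) +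
      ∑ a' : {a' // N.tgt a' = N.src a}, z a'.1 a'.2) * ξ a
  refine ⟨w, fun a => ?_⟩
  show N.wellFounded_precedes.fix _ a = _
  rw [WellFounded.fix_eq, inflow]
  congr 2
  exact (Finset.sum_subtype _ (by simp) w).symm

theorem inflow_pos (N : CoDAG I A AO) {g : ℝ} (hg : 0 < g) {w : A → ℝ} {i : I}
    (h : ∀ a, N.tgt a = i → 0 < w a) : 0 < N.inflow g w i := by
  by_cases ho : i = N.o
  · rw [ho, inflow_origin]; exact hg
  · rw [inflow, if_neg ho, zero_add]
    obtain ⟨a, ha⟩ := N.exists_tgt_eq ho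
    exact Finset.sum_pos (fun b hb => h b (Finset.mem_filter.1 hb).2) ⟨a, by simp [ha]⟩

theorem pos_of_split (N : CoDAG I A AO) {g : ℝ} (hg : 0 < g) {ξ w : A → ℝ}
    (hw : ∀ a, w a = N.inflow g w (N.src a) * ξ a) (hξ : ∀ a, 0 < ξ a) (a : A) : 0 < w a := by
  induction a using N.wellFounded_precedes.induction with
  | _ a ih => rw [hw]; exact mul_pos (N.inflow_pos hg ih) (hξ a)

theorem outflow_of_split (N : CoDAG I A AO) {g : ℝ} {ξ w : A → ℝ}
    (hw : ∀ a, w a = N.inflow g w (N.src a) * ξ a) (i : I) :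
    N.outflow w i = N.inflow g w i * N.outflow ξ i := by
  rw [outflow, outflow, Finset.mul_sum]
  refine Finset.sum_congr rfl fun a ha => ?_
  rw [hw, (Finset.mem_filter.1 ha).2]

theorem feasible_of_split (N : CoDAG I A AO) {g : ℝ} (hg : 0 < g) {ξ w : A → ℝ}
    (hw : ∀ a, w a = N.inflow g w (N.src a) * ξ a) (hξ : ∀ a, 0 < ξ a)
    (hsum : ∀ i, i ≠ N.d → N.outflow ξ i = 1) : w ∈ N.feasible g :=
  N.mem_feasible_iff.2 ⟨fun i hi => by rw [N.outflow_of_split hw, hsum i hi, mul_one],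
    fun a => (N.pos_of_split hg hw hξ a).le⟩

theorem outflow_eq_one_of_split (N : CoDAG I A AO) {g : ℝ} (hg : 0 < g) {ξ w : A → ℝ}
    (hw : ∀ a, w a = N.inflow g w (N.src a) * ξ a) (hξ : ∀ a, 0 < ξ a)
    (hf : w ∈ N.feasible g) {i : I} (hi : i ≠ N.d) : N.outflow ξ i = 1 := by
  have h1 := (N.mem_feasible_iff.1 hf).1 i hi
  have h2 := N.inflow_pos hg (i := i) fun a _ => N.pos_of_split hg hw hξ a
  rw [N.outflow_of_split hw] at h1
  exact mul_left_cancel₀ h2.ne' (h1.trans (mul_one _).symm)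

theorem outflow_pos (N : CoDAG I A AO) {w : A → ℝ} (hw : ∀ a, 0 < w a) {i : I} (hi : i ≠ N.d) :
    0 < N.outflow w i := by
  obtain ⟨a, ha⟩ := N.exists_src_eq hi
  exact Finset.sum_pos (fun b _ => hw b) ⟨a, by simp [ha]⟩

theorem outflow_ratio (N : CoDAG I A AO) {w : A → ℝ} (hw : ∀ a, 0 < w a) {i : I}
    (hi : i ≠ N.d) : N.outflow (fun a => w a / N.outflow w (N.src a)) i = 1 := by
  rw [← div_self (N.outflow_pos hw hi).ne']
  conv_rhs => rw [outflow, Finset.sum_div]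
  refine Finset.sum_congr rfl fun a ha => ?_
  simp only [(Finset.mem_filter.1 ha).2, outflow]

/-- Following a path back to the origin, the flow loses at most a factor `c` per arc, so the bound
depends only on the network, `g` and `c`. -/
theorem exists_lower_bound_of_split (N : CoDAG I A AO) {g c : ℝ} (hg : 0 < g) (hc : 0 < c) :
    ∃ C > 0, ∀ ξ w : A → ℝ, (∀ a, w a = N.inflow g w (N.src a) * ξ a) → (∀ a, c ≤ ξ a) →
      ∀ a, C ≤ w a := by
  have key : ∀ a, ∃ C > 0, ∀ ξ w : A → ℝ, (∀ a, w a = N.inflow g w (N.src a) * ξ a) →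
      (∀ a, c ≤ ξ a) → C ≤ w a := by
    intro a
    induction a using N.wellFounded_precedes.induction with
    | _ a ih =>
      by_cases ho : N.src a = N.o
      · refine ⟨g * c, mul_pos hg hc, fun ξ w hw hξ => ?_⟩
        rw [hw, ho, inflow_origin]
        exact mul_le_mul_of_nonneg_left (hξ a) hg.le
      · obtain ⟨b, hb⟩ := N.exists_tgt_eq ho
        obtain ⟨C, hC, h⟩ := ih b hb
        refine ⟨C * c, mul_pos hC hc, fun ξ w hw hξ => ?_⟩
        have hpos := N.pos_of_split hg hw fun a => hc.trans_le (hξ a)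
        have h1 : C ≤ N.inflow g w (N.src a) := by
          rw [inflow, if_neg ho, zero_add]
          exact (h ξ w hw hξ).trans
            (Finset.single_le_sum (f := w) (fun b _ => (hpos b).le) (by simp [hb]))
        rw [hw]
        exact mul_le_mul h1 (hξ a) hc.le (hC.le.trans h1)
  choose C hC h using key
  have := N.nonempty_arc
  obtain ⟨a₀, ha₀⟩ := Finite.exists_min C
  exact ⟨C a₀, hC a₀, fun ξ w hw hξ a => (ha₀ a).trans (h a ξ w hw hξ)⟩

/-! ### Gibbs' inequality at the nodes. -/

/-- The linear left side cancels when summed over the arcs leaving a node, if `p` and `q` have equal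
totals there; this yields Gibbs' inequality. -/
theorem sub_le_mul_log_div {p q : ℝ} (hp : 0 < p) (hq : 0 < q) :
    p - q ≤ p * Real.log (p / q) := by
  have h := mul_le_mul_of_nonneg_left (Real.one_sub_inv_le_log_of_pos (div_pos hp hq)) hp.le
  refine le_trans (le_of_eq ?_) h
  field_simp

theorem sub_lt_mul_log_div {p q : ℝ} (hp : 0 < p) (hq : 0 < q) (hpq : p ≠ q) :
    p - q < p * Real.log (p / q) := by
  have h := Real.log_lt_sub_one_of_pos (div_pos hq hp) (fun h => hpq ((div_eq_one_iff_eq hp.ne').1 h).symm)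
  have h1 : Real.log (p / q) = -Real.log (q / p) := by rw [← Real.log_inv, inv_div]
  have h2 := mul_lt_mul_of_pos_left h hp
  have h3 : p * (q / p - 1) = q - p := by field_simp
  rw [h1]
  linarith

/-- Gibbs' inequality, summed over the nodes with nonnegative weights. -/
theorem sum_mul_log_div_nonneg (N : CoDAG I A AO) {f : I → ℝ} {p q : A → ℝ}
    (hf : ∀ a, 0 ≤ f (N.src a)) (hp : ∀ a, 0 < p a) (hq : ∀ a, 0 < q a)
    (h : ∀ i, i ≠ N.d → N.outflow p i = N.outflow q i) :
    0 ≤ ∑ a, f (N.src a) * (p a * Real.log (p a / q a)) := by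
  have h1 : ∑ a, f (N.src a) * (p a - q a) = 0 := by
    simp only [mul_sub, Finset.sum_sub_distrib, N.sum_src_mul_congr f h, sub_self]
  rw [← h1]
  exact Finset.sum_le_sum fun a _ =>
    mul_le_mul_of_nonneg_left (sub_le_mul_log_div (hp a) (hq a)) (hf a)

theorem sum_mul_log_div_pos (N : CoDAG I A AO) {f : I → ℝ} {p q : A → ℝ}
    (hf : ∀ a, 0 < f (N.src a)) (hp : ∀ a, 0 < p a) (hq : ∀ a, 0 < q a)
    (h : ∀ i, i ≠ N.d → N.outflow p i = N.outflow q i) (hpq : p ≠ q) :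
    0 < ∑ a, f (N.src a) * (p a * Real.log (p a / q a)) := by
  have h1 : ∑ a, f (N.src a) * (p a - q a) = 0 := by
    simp only [mul_sub, Finset.sum_sub_distrib, N.sum_src_mul_congr f h, sub_self]
  rw [← h1]
  obtain ⟨a, ha⟩ := Function.ne_iff.1 hpq
  exact Finset.sum_lt_sum (fun a _ =>
    mul_le_mul_of_nonneg_left (sub_le_mul_log_div (hp a) (hq a)) (hf a).le)
    ⟨a, Finset.mem_univ a, mul_lt_mul_of_pos_left (sub_lt_mul_log_div (hp a) (hq a) ha) (hf a)⟩

/-! ### Topology of the feasible set and splitting ratios of positive flows. -/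

theorem isClosed_feasible (N : CoDAG I A AO) (g : ℝ) : IsClosed (N.feasible g) := by
  have h1 : ∀ i, Continuous fun w : A → ℝ => N.outflow w i := fun i => by
    unfold outflow; fun_prop
  have h2 : ∀ i, Continuous fun w : A → ℝ => N.inflow g w i := fun i => by
    unfold inflow; fun_prop
  have : N.feasible g = {w | (∀ i, i ≠ N.d → N.outflow w i = N.inflow g w i) ∧ ∀ a, 0 ≤ w a} :=
    Set.ext fun w => N.mem_feasible_iff
  rw [this, Set.ofPred_and]
  simp only [Set.ofPred_forall]
  exact (isClosed_iInter fun i => isClosed_iInter fun _ => isClosed_eq (h1 i) (h2 i)).inter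
    (isClosed_iInter fun a => isClosed_le continuous_const (continuous_apply a))

theorem isCompact_feasible (N : CoDAG I A AO) (g : ℝ) : IsCompact (N.feasible g) :=
  (isCompact_Icc (a := (0 : A → ℝ)) (b := fun _ => g)).of_isClosed_subset (N.isClosed_feasible g)
    fun _ hw => ⟨hw.2.2, N.le_demand hw⟩

theorem sum_exp_pos (N : CoDAG I A AO) (z : A → ℝ) {i : I} (hi : i ≠ N.d) :
    0 < ∑ a with N.src a = i, Real.exp (z a) := by
  obtain ⟨a, ha⟩ := N.exists_src_eq hi
  exact Finset.sum_pos (fun b _ => Real.exp_pos _) ⟨a, by simp [ha]⟩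

theorem continuousOn_ratio (N : CoDAG I A AO) (a : A) :
    ContinuousOn (fun w : A → ℝ => w a / N.outflow w (N.src a)) {w | ∀ a, 0 < w a} := by
  refine ContinuousOn.div (by fun_prop) ?_ fun w hw => (N.outflow_pos hw (N.src_ne_d a)).ne'
  unfold outflow
  fun_prop

theorem ratio_pos (N : CoDAG I A AO) {w : A → ℝ} (hw : ∀ a, 0 < w a) (a : A) :
    0 < w a / N.outflow w (N.src a) :=
  div_pos (hw a) (N.outflow_pos hw (N.src_ne_d a))

theorem outflow_sub (N : CoDAG I A AO) {g : ℝ} {v w : A → ℝ} (hv : v ∈ N.feasible g)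
    (hw : w ∈ N.feasible g) (i : I) (hi : i ≠ N.d) :
    N.outflow (fun a => v a - w a) i = N.inflow 0 (fun a => v a - w a) i := by
  have h1 := (N.mem_feasible_iff.1 hv).1 i hi
  have h2 := (N.mem_feasible_iff.1 hw).1 i hi
  simp only [outflow, inflow, Finset.sum_sub_distrib] at h1 h2 ⊢
  rw [h1, h2]
  simp

theorem split_ratio (N : CoDAG I A AO) {g : ℝ} {w : A → ℝ} (hw : w ∈ N.feasible g)
    (hpos : ∀ a, 0 < w a) (a : A) :
    w a = N.inflow g w (N.src a) * (w a / N.outflow w (N.src a)) := by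
  have hd := N.src_ne_d a
  rw [← (N.mem_feasible_iff.1 hw).1 _ hd, mul_div_cancel₀ _ (N.outflow_pos hpos hd).ne']

/-- Relative entropies only compare splitting ratios; this passes from ratios back to flows in the
strictness argument. -/
theorem eq_of_ratio_eq (N : CoDAG I A AO) {g : ℝ} {v w : A → ℝ} (hv : v ∈ N.feasible g)
    (hw : w ∈ N.feasible g) (hv0 : ∀ a, 0 < v a) (hw0 : ∀ a, 0 < w a)
    (h : ∀ a, v a / N.outflow v (N.src a) = w a / N.outflow w (N.src a)) : v = w := by
  refine N.eq_of_split (N.split_ratio hv hv0) fun a => ?_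
  rw [h]
  exact N.split_ratio hw hw0 a

end CoDAG

/-! ### Choice probabilities and node costs. -/

namespace CoDAG

variable {I A AO : Type*} [Fintype A] [DecidableEq I] [DecidableEq AO]

theorem choiceProb_pos (N : CoDAG I A AO) (s : AO → ℝ → ℝ) (β : ℝ) (w : A → ℝ) (a : A) :
    0 < N.choiceProb s β w a :=
  div_pos (Real.exp_pos _) (N.sum_exp_pos _ (N.src_ne_d a))

theorem outflow_choiceProb (N : CoDAG I A AO) (s : AO → ℝ → ℝ) (β : ℝ) (w : A → ℝ) {i : I}
    (hi : i ≠ N.d) : N.outflow (N.choiceProb s β w) i = 1 := by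
  rw [← div_self (N.sum_exp_pos (fun a => -β * N.costToGo s β w a) hi).ne', outflow,
    Finset.sum_div]
  refine Finset.sum_congr rfl fun a ha => ?_
  rw [choiceProb, (Finset.mem_filter.1 ha).2]

theorem choiceProb_le_one (N : CoDAG I A AO) (s : AO → ℝ → ℝ) (β : ℝ) (w : A → ℝ) (a : A) :
    N.choiceProb s β w a ≤ 1 :=
  (N.le_outflow (fun b => (N.choiceProb_pos s β w b).le) a).trans_eq
    (N.outflow_choiceProb s β w (N.src_ne_d a))

/-- The expected latency from a node to the destination. -/
noncomputable def nodeCost (N : CoDAG I A AO) (s : AO → ℝ → ℝ) (β : ℝ) (w : A → ℝ) (i : I) : ℝ :=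
  if i = N.d then 0
  else -(1 / β * Real.log (∑ a with N.src a = i, Real.exp (-β * N.costToGo s β w a)))

/-- Logit choice makes ln `choiceProb` equal to β times the node cost at the start minus the arc's
cost-to-go, and the latter is latency plus node cost at the end. -/
theorem latency_eq (N : CoDAG I A AO) (s : AO → ℝ → ℝ) {β : ℝ} (hβ : 0 < β) (w : A → ℝ) (a : A) :
    s (N.lab a) (N.origFlow w a) = N.nodeCost s β w (N.src a) - N.nodeCost s β w (N.tgt a)
      - 1 / β * Real.log (N.choiceProb s β w a) := by
  have h1 : N.costToGo s β w a = s (N.lab a) (N.origFlow w a) + N.nodeCost s β w (N.tgt a) := by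
    rw [costToGo_eq, nodeCost]
    split_ifs <;> ring
  have h2 : 1 / β * Real.log (N.choiceProb s β w a)
      = N.nodeCost s β w (N.src a) - N.costToGo s β w a := by
    rw [nodeCost, if_neg (N.src_ne_d a), choiceProb, Real.log_div (Real.exp_pos _).ne'
      (N.sum_exp_pos _ (N.src_ne_d a)).ne', Real.log_exp]
    field_simp
    ring
  rw [h2, h1]
  ring

theorem continuousOn_costToGo (N : CoDAG I A AO) {s : AO → ℝ → ℝ}
    (hs : ∀ e, ContinuousOn (s e) (Set.Ici 0)) (β : ℝ) (a : A) :
    ContinuousOn (fun w => N.costToGo s β w a) {w | ∀ a, 0 ≤ w a} := by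
  induction a using N.wellFounded_follows.induction with
  | _ a ih =>
    have h1 : ContinuousOn (fun w => s (N.lab a) (N.origFlow w a)) {w | ∀ a, 0 ≤ w a} := by
      refine (hs (N.lab a)).comp (Continuous.continuousOn ?_)
        fun w hw => Finset.sum_nonneg fun b _ => hw b
      unfold origFlow
      fun_prop
    by_cases hd : N.tgt a = N.d
    · simpa only [costToGo_eq N s β _ a, if_pos hd] using h1
    · simp only [costToGo_eq N s β _ a, if_neg hd]
      refine h1.sub (continuousOn_const.mul (ContinuousOn.log ?_ fun w _ =>
        (N.sum_exp_pos _ hd).ne'))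
      exact continuousOn_finsetSum _ fun b hb =>
        (continuousOn_const.mul (ih b (Finset.mem_filter.1 hb).2)).rexp

theorem continuousOn_choiceProb (N : CoDAG I A AO) {s : AO → ℝ → ℝ}
    (hs : ∀ e, ContinuousOn (s e) (Set.Ici 0)) (β : ℝ) (a : A) :
    ContinuousOn (fun w => N.choiceProb s β w a) {w | ∀ a, 0 ≤ w a} := by
  have h : ∀ b, ContinuousOn (fun w => Real.exp (-β * N.costToGo s β w b)) {w | ∀ a, 0 ≤ w a} :=
    fun b => (continuousOn_const.mul (N.continuousOn_costToGo hs β b)).rexp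
  exact (h a).div (continuousOn_finsetSum _ fun b _ => h b)
    fun w _ => (N.sum_exp_pos _ (N.src_ne_d a)).ne'

/-- Positive continuous functions on the compact box [0, g]^A, which contains all feasible flows. -/
theorem exists_choiceProb_lower_bound (N : CoDAG I A AO) {s : AO → ℝ → ℝ}
    (hs : ∀ e, ContinuousOn (s e) (Set.Ici 0)) (β : ℝ) {g : ℝ} (hg : 0 < g) :
    ∃ c > 0, ∀ w ∈ Set.Icc (0 : A → ℝ) (fun _ => g), ∀ a, c ≤ N.choiceProb s β w a := by
  have key : ∀ a, ∃ c > 0, ∀ w ∈ Set.Icc (0 : A → ℝ) (fun _ => g), c ≤ N.choiceProb s β w a := by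
    intro a
    obtain ⟨v, _, hv⟩ := (isCompact_Icc (a := (0 : A → ℝ)) (b := fun _ => g)).exists_isMinOn
      ⟨0, le_rfl, fun _ => hg.le⟩ ((N.continuousOn_choiceProb hs β a).mono fun w hw => hw.1)
    exact ⟨_, N.choiceProb_pos s β v a, fun w hw => hv hw⟩
  choose c hc h using key
  have := N.nonempty_arc
  obtain ⟨a₀, ha₀⟩ := Finite.exists_min c
  exact ⟨c a₀, hc a₀, fun w hw a => (ha₀ a).trans (h a w hw)⟩

/-! ### The potential: gradient, convexity, minimizer. -/

/-- The strictly convex potential whose minimizer over the feasible flows is the equilibrium. -/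
noncomputable def potential (N : CoDAG I A AO) (s : AO → ℝ → ℝ) (β : ℝ) (w : A → ℝ) : ℝ :=
  ∑ e ∈ Finset.univ.image N.lab, (∫ u in (0 : ℝ)..∑ a with N.lab a = e, w a, s e (max u 0)) +
    1 / β * ∑ a, w a * Real.log (w a / N.outflow w (N.src a))

/-- Freezing the latency at its value at 0 on the negative axis gives a globally continuous
integrand, so the fundamental theorem of calculus applies at every flow total. -/
theorem continuous_extend {f : ℝ → ℝ} (hf : ContinuousOn f (Set.Ici 0)) :
    Continuous fun u => f (max u 0) :=
  hf.comp_continuous (by fun_prop) fun _ => Set.mem_Ici.2 (le_max_right _ _)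

theorem hasDerivWithinAt_potential (N : CoDAG I A AO) {s : AO → ℝ → ℝ}
    (hs : ∀ e, ContinuousOn (s e) (Set.Ici 0)) (β : ℝ) {w : ℝ → A → ℝ} {w' : A → ℝ} {T : Set ℝ}
    {t : ℝ} (hw : ∀ a, HasDerivWithinAt (fun τ => w τ a) (w' a) T t) (hpos : ∀ a, 0 < w t a) :
    HasDerivWithinAt (fun τ => N.potential s β (w τ))
      (∑ a, w' a * (s (N.lab a) (N.origFlow (w t) a) +
        1 / β * Real.log (w t a / N.outflow (w t) (N.src a)))) T t := by
  have hlab : HasDerivWithinAt (fun τ => ∑ e ∈ Finset.univ.image N.lab,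
      (∫ u in (0 : ℝ)..∑ a with N.lab a = e, w τ a, s e (max u 0)))
      (∑ a, w' a * s (N.lab a) (N.origFlow (w t) a)) T t := by
    have h1 : ∀ e ∈ Finset.univ.image N.lab, HasDerivWithinAt
        (fun τ => ∫ u in (0 : ℝ)..∑ a with N.lab a = e, w τ a, s e (max u 0))
        (s e (max (∑ a with N.lab a = e, w t a) 0) * ∑ a with N.lab a = e, w' a) T t := by
      intro e _
      exact ((continuous_extend (hs e)).integral_hasStrictDerivAt 0
        (∑ a with N.lab a = e, w t a)).hasDerivAt.comp_hasDerivWithinAt t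
        (HasDerivWithinAt.fun_sum fun a _ => hw a)
    refine (HasDerivWithinAt.fun_sum h1).congr_deriv (Eq.symm ?_)
    rw [← Finset.sum_fiberwise_of_maps_to (g := N.lab) (t := Finset.univ.image N.lab)
      (fun a _ => Finset.mem_image_of_mem _ (Finset.mem_univ a))]
    refine Finset.sum_congr rfl fun e _ => ?_
    rw [max_eq_left (Finset.sum_nonneg fun a _ => (hpos a).le), Finset.mul_sum]
    refine Finset.sum_congr rfl fun a ha => ?_
    rw [origFlow, (Finset.mem_filter.1 ha).2, mul_comm]
  have hent : HasDerivWithinAt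
      (fun τ => ∑ a, w τ a * Real.log (w τ a / N.outflow (w τ) (N.src a)))
      (∑ a, w' a * Real.log (w t a / N.outflow (w t) (N.src a))) T t := by
    have h1 : ∀ a ∈ Finset.univ, HasDerivWithinAt
        (fun τ => w τ a * Real.log (w τ a / N.outflow (w τ) (N.src a)))
        (w' a * Real.log (w t a / N.outflow (w t) (N.src a)) +
          (w' a - N.outflow w' (N.src a) / N.outflow (w t) (N.src a) * w t a)) T t := by
      intro a _
      have hx := N.outflow_pos hpos (N.src_ne_d a)
      have h2 : HasDerivWithinAt (fun τ => N.outflow (w τ) (N.src a))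
        (N.outflow w' (N.src a)) T t := HasDerivWithinAt.fun_sum fun b _ => hw b
      have h3 := (hw a).mul (((hw a).div h2 hx.ne').log (div_pos (hpos a) hx).ne')
      refine h3.congr_deriv ?_
      have := (hpos a).ne'
      simp only [Pi.div_apply]
      field_simp
    refine (HasDerivWithinAt.fun_sum h1).congr_deriv ?_
    -- Differentiating inside the logarithms leaves ∑ (w'_a - x'_i w_a / x_i), which cancels at each
    -- node because x_i is the sum of its w_a.
    rw [Finset.sum_add_distrib, add_eq_left, Finset.sum_sub_distrib, sub_eq_zero]
    let U : Finset I := Finset.univ.image N.src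
    have hU : ∀ a, N.src a ∈ U := fun a => Finset.mem_image_of_mem _ (Finset.mem_univ a)
    have h4 := N.sum_src_mul U hU (fun _ => 1) w'
    have h5 := N.sum_src_mul U hU (fun i => N.outflow w' i / N.outflow (w t) i) (w t)
    simp only [one_mul] at h4
    rw [h4, h5]
    refine Finset.sum_congr rfl fun i hi => ?_
    obtain ⟨a, _, rfl⟩ := Finset.mem_image.1 hi
    exact (div_mul_cancel₀ _ (N.outflow_pos hpos (N.src_ne_d a)).ne').symm
  refine (hlab.add (hent.const_mul (1 / β))).congr_deriv ?_
  rw [Finset.mul_sum, ← Finset.sum_add_distrib]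
  exact Finset.sum_congr rfl fun a _ => by ring

theorem continuousOn_potential (N : CoDAG I A AO) {s : AO → ℝ → ℝ}
    (hs : ∀ e, ContinuousOn (s e) (Set.Ici 0)) (β : ℝ) :
    ContinuousOn (N.potential s β) {w | ∀ a, 0 < w a} := by
  refine ContinuousOn.add (continuousOn_finsetSum _ fun e _ => Continuous.continuousOn ?_)
    (continuousOn_const.mul (continuousOn_finsetSum _ fun a _ => ContinuousOn.mul (by fun_prop)
      ((N.continuousOn_ratio a).log fun w hw => (N.ratio_pos hw a).ne')))
  exact (continuous_iff_continuousAt.2 fun x =>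
    ((continuous_extend (hs e)).integral_hasStrictDerivAt 0 x).hasDerivAt.continuousAt).comp
      (by fun_prop : Continuous fun w : A → ℝ => ∑ a with N.lab a = e, w a)

/-- On feasible directions, the gradient of the potential is the log-ratio of the actual splitting
ratios to the choice probabilities. -/
theorem sum_mul_gradient (N : CoDAG I A AO) (s : AO → ℝ → ℝ) {β : ℝ} (hβ : 0 < β)
    {w u : A → ℝ} (hw : ∀ a, 0 < w a) (hu : ∀ i, i ≠ N.d → N.outflow u i = N.inflow 0 u i) :
    ∑ a, u a * (s (N.lab a) (N.origFlow w a) +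
        1 / β * Real.log (w a / N.outflow w (N.src a))) =
      1 / β * ∑ a, u a * Real.log (w a / N.outflow w (N.src a) / N.choiceProb s β w a) := by
  -- The node costs, used as a potential, contribute nothing along `u`.
  have h := N.sum_mul_potential_diff hu (N.nodeCost s β w) (if_pos rfl)
  rw [zero_mul] at h
  rw [← add_zero (1 / β * _), ← h, Finset.mul_sum, ← Finset.sum_add_distrib]
  refine Finset.sum_congr rfl fun a _ => ?_
  rw [N.latency_eq s hβ, Real.log_div (N.ratio_pos hw a).ne' (N.choiceProb_pos s β w a).ne']
  ring

theorem le_integral_of_monotone {f : ℝ → ℝ} (hf : Continuous f) (hm : Monotone f) (x y : ℝ) :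
    (y - x) * f x ≤ ∫ u in x..y, f u := by
  rcases le_total x y with h | h
  · have := intervalIntegral.integral_mono_on (μ := MeasureTheory.volume) h
      (continuous_const.intervalIntegrable x y)
      (hf.intervalIntegrable x y) (fun u hu => hm hu.1)
    simpa using this
  · have := intervalIntegral.integral_mono_on (μ := MeasureTheory.volume) h
      (hf.intervalIntegrable y x)
      (continuous_const.intervalIntegrable y x) (fun u hu => hm hu.2)
    rw [intervalIntegral.integral_symm]
    simp only [intervalIntegral.integral_const, smul_eq_mul] at this
    linarith

/-- Strong form of the convexity inequality for the potential at an equilibrium. -/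
theorem potential_sub_ge (N : CoDAG I A AO) {s : AO → ℝ → ℝ}
    (hs_cont : ∀ e, ContinuousOn (s e) (Set.Ici 0)) (hs_mono : ∀ e, StrictMonoOn (s e) (Set.Ici 0))
    {β g : ℝ} (hβ : 0 < β) {v w : A → ℝ} (hv : v ∈ N.feasible g) (hw : w ∈ N.feasible g)
    (hv0 : ∀ a, 0 < v a) (hw0 : ∀ a, 0 < w a)
    (heq : ∀ a, w a / N.outflow w (N.src a) = N.choiceProb s β w a) :
    1 / β * ∑ a, v a * Real.log (v a / N.outflow v (N.src a) / (w a / N.outflow w (N.src a))) ≤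
      N.potential s β v - N.potential s β w := by
  have hgrad := N.sum_mul_gradient s hβ hw0 (N.outflow_sub hv hw)
  have hzero : ∑ a, (v a - w a) *
      Real.log (w a / N.outflow w (N.src a) / N.choiceProb s β w a) = 0 := by
    refine Finset.sum_eq_zero fun a _ => ?_
    rw [heq, div_self (N.choiceProb_pos s β w a).ne', Real.log_one, mul_zero]
  rw [hzero, mul_zero] at hgrad
  -- Each latency integral is convex in the total flow of its original arc, so it lies above its
  -- tangent at `w`.
  have hint : ∑ a, (v a - w a) * s (N.lab a) (N.origFlow w a) ≤
      ∑ e ∈ Finset.univ.image N.lab, (∫ u in (0 : ℝ)..∑ a with N.lab a = e, v a, s e (max u 0)) -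
      ∑ e ∈ Finset.univ.image N.lab, (∫ u in (0 : ℝ)..∑ a with N.lab a = e, w a, s e (max u 0)) := by
    rw [← Finset.sum_sub_distrib,
      ← Finset.sum_fiberwise_of_maps_to (g := N.lab) (t := Finset.univ.image N.lab)
      (fun a _ => Finset.mem_image_of_mem _ (Finset.mem_univ a))]
    refine Finset.sum_le_sum fun e _ => ?_
    have hc := continuous_extend (hs_cont e)
    rw [intervalIntegral.integral_interval_sub_left (hc.intervalIntegrable _ _)
      (hc.intervalIntegrable _ _)]
    refine le_trans (le_of_eq ?_) (le_integral_of_monotone hc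
      (fun x y hxy => (hs_mono e).monotoneOn (Set.mem_Ici.2 (le_max_right _ _))
        (Set.mem_Ici.2 (le_max_right _ _))
        (max_le_max_right 0 hxy)) _ _)
    rw [max_eq_left (Finset.sum_nonneg fun a _ => (hw0 a).le), ← Finset.sum_sub_distrib,
      Finset.sum_mul]
    refine Finset.sum_congr rfl fun a ha => ?_
    rw [origFlow, (Finset.mem_filter.1 ha).2]
  -- The left side is the Bregman divergence of the entropy term.
  have hlog : ∑ a, v a * Real.log (v a / N.outflow v (N.src a) / (w a / N.outflow w (N.src a))) =
      ∑ a, v a * Real.log (v a / N.outflow v (N.src a)) -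
        ∑ a, w a * Real.log (w a / N.outflow w (N.src a)) -
        ∑ a, (v a - w a) * Real.log (w a / N.outflow w (N.src a)) := by
    rw [← Finset.sum_sub_distrib, ← Finset.sum_sub_distrib]
    refine Finset.sum_congr rfl fun a _ => ?_
    rw [Real.log_div (N.ratio_pos hv0 a).ne' (N.ratio_pos hw0 a).ne']
    ring
  have hsplit : ∑ a, (v a - w a) * (s (N.lab a) (N.origFlow w a) +
        1 / β * Real.log (w a / N.outflow w (N.src a))) =
      ∑ a, (v a - w a) * s (N.lab a) (N.origFlow w a) +
        1 / β * ∑ a, (v a - w a) * Real.log (w a / N.outflow w (N.src a)) := by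
    rw [Finset.mul_sum, ← Finset.sum_add_distrib]
    exact Finset.sum_congr rfl fun a _ => by ring
  rw [hlog, potential, potential, mul_sub, mul_sub]
  linarith

theorem IsEquilibrium.pos {N : CoDAG I A AO} {s : AO → ℝ → ℝ} {β g : ℝ} (hg : 0 < g)
    {w : A → ℝ} (h : N.IsEquilibrium s β g w) (a : A) : 0 < w a :=
  N.pos_of_split hg h.2 (N.choiceProb_pos s β w) a

theorem isEquilibrium_iff_ratio (N : CoDAG I A AO) {s : AO → ℝ → ℝ} {β g : ℝ}
    {w : A → ℝ} (hw : w ∈ N.feasible g) (hpos : ∀ a, 0 < w a) :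
    N.IsEquilibrium s β g w ↔ ∀ a, w a / N.outflow w (N.src a) = N.choiceProb s β w a := by
  have h : ∀ a, N.inflow g w (N.src a) = N.outflow w (N.src a) := fun a =>
    ((N.mem_feasible_iff.1 hw).1 _ (N.src_ne_d a)).symm
  constructor
  · intro he a
    rw [div_eq_iff (N.outflow_pos hpos (N.src_ne_d a)).ne', mul_comm, ← h]
    exact he.2 a
  · intro he
    refine ⟨hw, fun a => ?_⟩
    rw [h, ← he, mul_div_cancel₀ _ (N.outflow_pos hpos (N.src_ne_d a)).ne']

/-- The equilibrium is the strict minimizer of the potential among positive feasible flows. -/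
theorem IsEquilibrium.potential_lt {N : CoDAG I A AO} {s : AO → ℝ → ℝ}
    (hs_cont : ∀ e, ContinuousOn (s e) (Set.Ici 0)) (hs_mono : ∀ e, StrictMonoOn (s e) (Set.Ici 0))
    {β g : ℝ} (hβ : 0 < β) (hg : 0 < g) {v w : A → ℝ} (hw : N.IsEquilibrium s β g w)
    (hv : v ∈ N.feasible g) (hv0 : ∀ a, 0 < v a) (hne : v ≠ w) :
    N.potential s β w < N.potential s β v := by
  have hw0 := hw.pos hg
  have h1 := N.potential_sub_ge hs_cont hs_mono hβ hv hw.1 hv0 hw0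
    ((N.isEquilibrium_iff_ratio hw.1 hw0).1 hw)
  have h2 := N.sum_mul_log_div_pos (f := N.outflow v) (fun a => N.outflow_pos hv0 (N.src_ne_d a))
    (N.ratio_pos hv0) (N.ratio_pos hw0)
    (fun i hi => by rw [N.outflow_ratio hv0 hi, N.outflow_ratio hw0 hi])
    (fun h => hne (N.eq_of_ratio_eq hv hw.1 hv0 hw0 (congrFun h)))
  have h3 : ∑ a, N.outflow v (N.src a) * (v a / N.outflow v (N.src a) *
      Real.log (v a / N.outflow v (N.src a) / (w a / N.outflow w (N.src a)))) =
      ∑ a, v a * Real.log (v a / N.outflow v (N.src a) / (w a / N.outflow w (N.src a))) := by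
    refine Finset.sum_congr rfl fun a _ => ?_
    rw [← mul_assoc, mul_div_cancel₀ _ (N.outflow_pos hv0 (N.src_ne_d a)).ne']
  rw [h3] at h2
  have := mul_pos (one_div_pos.2 hβ) h2
  linarith

theorem deriv_nonneg_of_min_left {f : ℝ → ℝ} {f' : ℝ} (hf : HasDerivWithinAt f f' (Set.Icc 0 1) 0)
    (hmin : ∀ t ∈ Set.Icc (0 : ℝ) 1, f 0 ≤ f t) : 0 ≤ f' := by
  have h : IsLocalMinOn f (Set.Icc 0 1) 0 := eventually_of_mem self_mem_nhdsWithin hmin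
  have := h.hasFDerivWithinAt_nonneg hf.hasFDerivWithinAt (y := 1)
    (mem_posTangentConeAt_of_segment_subset (by rw [segment_eq_Icc] <;> norm_num))
  simpa using this

/-! ### Existence of an equilibrium. -/

/-- Minimize the potential over flows whose splitting ratios are at least `c`. This keeps the
minimizer `w` off the boundary, where the logarithms are singular. The flow `v` split according to
the choice probabilities at `w` is again admissible, and moving towards it strictly lowers the
potential unless `w` is an equilibrium. -/
theorem exists_isEquilibrium (N : CoDAG I A AO) {s : AO → ℝ → ℝ}
    (hs : ∀ e, ContinuousOn (s e) (Set.Ici 0)) {β g : ℝ} (hβ : 0 < β) (hg : 0 < g) :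
    ∃ w, N.IsEquilibrium s β g w := by
  obtain ⟨c, hc, hP⟩ := N.exists_choiceProb_lower_bound hs β hg
  let M : Set (A → ℝ) := N.feasible g ∩ {w | ∀ a, c * N.inflow g w (N.src a) ≤ w a}
  have hMpos : ∀ w ∈ M, ∀ a, 0 < w a := by
    rintro w ⟨_, hw⟩ a
    induction a using N.wellFounded_precedes.induction with
    | _ a ih => exact (mul_pos hc (N.inflow_pos hg ih)).trans_le (hw a)
  have hMcomp : IsCompact M := by
    refine (N.isCompact_feasible g).inter_right ?_
    simp only [Set.ofPred_forall]
    refine isClosed_iInter fun a => isClosed_le ?_ (continuous_apply a)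
    unfold inflow
    fun_prop
  have hsplit : ∀ u ∈ Set.Icc (0 : A → ℝ) (fun _ => g), ∃ v ∈ M,
      ∀ a, v a = N.inflow g v (N.src a) * N.choiceProb s β u a := by
    intro u hu
    obtain ⟨v, hv⟩ := N.exists_split g (N.choiceProb s β u)
    have hpos := N.pos_of_split hg hv (N.choiceProb_pos s β u)
    refine ⟨v, ⟨N.feasible_of_split hg hv (N.choiceProb_pos s β u)
      fun i hi => N.outflow_choiceProb s β u hi, fun a => ?_⟩, hv⟩
    conv_rhs => rw [hv a, mul_comm]
    exact mul_le_mul_of_nonneg_right (hP u hu a) (N.inflow_pos hg fun b _ => hpos b).le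
  obtain ⟨v₀, hv₀, _⟩ := hsplit 0 ⟨le_rfl, fun _ => hg.le⟩
  obtain ⟨w, hwM, hmin⟩ := hMcomp.exists_isMinOn ⟨v₀, hv₀⟩
    ((N.continuousOn_potential hs β).mono hMpos)
  have hw0 := hMpos w hwM
  have hwf := hwM.1
  obtain ⟨v, hvM, hv⟩ := hsplit w ⟨hwf.2.2, N.le_demand hwf⟩
  have hv0 := hMpos v hvM
  refine ⟨w, (N.isEquilibrium_iff_ratio hwf hw0).2 ?_⟩
  by_contra hne
  let γ : ℝ → A → ℝ := fun τ a => w a + τ * (v a - w a)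
  have hγ0 : γ 0 = w := funext fun a => by simp [γ]
  have hγM : ∀ τ ∈ Set.Icc (0 : ℝ) 1, γ τ ∈ M := by
    rintro τ ⟨h0, h1⟩
    have hγ : ∀ a, γ τ a = (1 - τ) * w a + τ * v a := fun a => by simp only [γ]; ring
    have hin : ∀ i, N.inflow g (γ τ) i = (1 - τ) * N.inflow g w i + τ * N.inflow g v i := by
      intro i
      simp only [inflow, hγ, Finset.sum_add_distrib, ← Finset.mul_sum]
      ring
    refine ⟨N.mem_feasible_iff.2 ⟨fun i hi => ?_, fun a => ?_⟩, fun a => ?_⟩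
    · rw [hin, ← (N.mem_feasible_iff.1 hwf).1 i hi, ← (N.mem_feasible_iff.1 hvM.1).1 i hi]
      simp only [outflow, hγ, Finset.sum_add_distrib, ← Finset.mul_sum]
    · rw [hγ]
      exact add_nonneg (mul_nonneg (by linarith) (hw0 a).le) (mul_nonneg h0 (hv0 a).le)
    · rw [hγ, hin]
      have := mul_le_mul_of_nonneg_left (hwM.2 a) (by linarith : 0 ≤ 1 - τ)
      have := mul_le_mul_of_nonneg_left (hvM.2 a) h0
      linarith
  have hder : HasDerivWithinAt (fun τ => N.potential s β (γ τ)) _ (Set.Icc 0 1) 0 :=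
    N.hasDerivWithinAt_potential hs β (w := γ) (w' := fun a => v a - w a)
      (fun a => by
        have := ((hasDerivWithinAt_id (0 : ℝ) (Set.Icc 0 1)).mul_const (v a - w a)).const_add (w a)
        simpa [γ] using this)
      (by rw [hγ0]; exact hw0)
  have hnn := deriv_nonneg_of_min_left hder fun τ hτ => by
    rw [hγ0]; exact hmin (hγM τ hτ)
  rw [hγ0, N.sum_mul_gradient s hβ hw0 (N.outflow_sub hvM.1 hwf)] at hnn
  have hout : ∀ u : A → ℝ, (∀ a, 0 < u a) → ∀ a, 0 < N.outflow u (N.src a) := fun u hu a =>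
    N.outflow_pos hu (N.src_ne_d a)
  have hsum : ∀ i, i ≠ N.d → N.outflow (fun a => w a / N.outflow w (N.src a)) i =
      N.outflow (N.choiceProb s β w) i := fun i hi => by
    rw [N.outflow_ratio hw0 hi, N.outflow_choiceProb s β w hi]
  have h1 := N.sum_mul_log_div_pos (f := N.outflow w) (hout w hw0) (N.ratio_pos hw0)
    (N.choiceProb_pos s β w) hsum fun h => hne (congrFun h)
  have h2 := N.sum_mul_log_div_nonneg (f := N.outflow v) (fun a => (hout v hv0 a).le)
    (N.choiceProb_pos s β w) (N.ratio_pos hw0) fun i hi => (hsum i hi).symm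
  -- With v_a = x_i(v) P_a and w_a = x_i(w) ξ_a, both halves of the directional derivative become
  -- negated weighted relative entropies.
  have h3 : ∑ a, (v a - w a) *
      Real.log (w a / N.outflow w (N.src a) / N.choiceProb s β w a) =
      -(∑ a, N.outflow v (N.src a) * (N.choiceProb s β w a *
          Real.log (N.choiceProb s β w a / (w a / N.outflow w (N.src a))))) -
      ∑ a, N.outflow w (N.src a) * (w a / N.outflow w (N.src a) *
          Real.log (w a / N.outflow w (N.src a) / N.choiceProb s β w a)) := by
    rw [← Finset.sum_neg_distrib, ← Finset.sum_sub_distrib]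
    refine Finset.sum_congr rfl fun a _ => ?_
    have e1 : Real.log (N.choiceProb s β w a / (w a / N.outflow w (N.src a))) =
      -Real.log (w a / N.outflow w (N.src a) / N.choiceProb s β w a) := by
      rw [← Real.log_inv, inv_div]
    have e2 : N.outflow w (N.src a) * (w a / N.outflow w (N.src a)) = w a :=
      mul_div_cancel₀ _ (hout w hw0 a).ne'
    have e3 : N.outflow v (N.src a) * N.choiceProb s β w a = v a := by
      rw [(N.mem_feasible_iff.1 hvM.1).1 _ (N.src_ne_d a), ← hv a]
    rw [e1, ← mul_assoc, ← mul_assoc, e2, e3]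
    ring
  rw [h3] at hnn
  have := mul_neg_of_pos_of_neg (one_div_pos.2 hβ) (by linarith : -(∑ a, N.outflow v (N.src a) *
    (N.choiceProb s β w a * Real.log (N.choiceProb s β w a / (w a / N.outflow w (N.src a))))) -
      ∑ a, N.outflow w (N.src a) * (w a / N.outflow w (N.src a) *
          Real.log (w a / N.outflow w (N.src a) / N.choiceProb s β w a)) < 0)
  linarith

end CoDAG

/-! ### Differential inequalities and the growth of node flows. -/

namespace CoDAG

theorem monotoneOn_Ici_of_deriv_nonneg {f f' : ℝ → ℝ}
    (hf : ∀ t, 0 ≤ t → HasDerivWithinAt f (f' t) (Set.Ici 0) t) (h : ∀ t, 0 ≤ t → 0 ≤ f' t) :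
    MonotoneOn f (Set.Ici 0) :=
  monotoneOn_of_hasDerivWithinAt_nonneg (convex_Ici 0) (fun t ht => (hf t ht).continuousWithinAt)
    (fun t ht => (hf t (interior_subset ht)).mono interior_subset)
    (fun t ht => h t (interior_subset ht))

/-- A differential inequality of Grönwall type: `f' ≥ -k f` implies `f t ≥ f 0 * exp (-k t)`. -/
theorem le_mul_exp_of_deriv_ge {f f' : ℝ → ℝ} {k : ℝ}
    (hf : ∀ t, 0 ≤ t → HasDerivWithinAt f (f' t) (Set.Ici 0) t)
    (h : ∀ t, 0 ≤ t → -(k * f t) ≤ f' t) {t : ℝ} (ht : 0 ≤ t) : f 0 ≤ f t * Real.exp (k * t) := by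
  have hd : ∀ τ, 0 ≤ τ → HasDerivWithinAt (fun τ => f τ * Real.exp (k * τ))
      ((f' τ + k * f τ) * Real.exp (k * τ)) (Set.Ici 0) τ := by
    intro τ hτ
    have h1 : HasDerivWithinAt (fun τ : ℝ => k * τ) k (Set.Ici 0) τ := by
      simpa using (hasDerivWithinAt_id τ (Set.Ici 0)).const_mul k
    exact ((hf τ hτ).mul h1.exp).congr_deriv (by ring)
  have hm := monotoneOn_Ici_of_deriv_nonneg hd fun τ hτ =>
    mul_nonneg (by linarith [h τ hτ]) (Real.exp_pos _).le
  simpa using hm (Set.mem_Ici.2 le_rfl) (Set.mem_Ici.2 ht) ht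

variable {I A AO : Type*} [Fintype A] [DecidableEq I]

/-- Induction from the origin. If x'_i ≤ K_i x_i at the start of an arc, the ξ terms in w'_a leave
w'_a ≤ K_i x_i P_a ≤ K_i g. The rate condition bounds this by K_j C ≤ K_j w_a at the end node j, and
summing over the arcs into j gives x'_j ≤ K_j x_j. -/
theorem inflow_le_of_growth (N : CoDAG I A AO) {g C : ℝ} {K : I → ℝ} {w p x w' : A → ℝ}
    (hC : 0 < C) (hg : 0 < g) (hK : ∀ i, i ≠ N.d → 0 < K i)
    (hrate : ∀ i, i ≠ N.d → ∀ a, N.tgt a = i → g / C * K (N.src a) < K i)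
    (hw : ∀ a, C ≤ w a) (hx : ∀ a, N.inflow g w (N.src a) ≤ g) (hp1 : ∀ a, p a ≤ 1)
    (hx0 : ∀ a, 0 ≤ x a)
    (hw' : ∀ a, w' a = N.inflow 0 w' (N.src a) * x a +
      N.inflow g w (N.src a) * (K (N.src a) * (-x a + p a))) :
    ∀ a, N.inflow 0 w' (N.src a) ≤ K (N.src a) * N.inflow g w (N.src a) := by
  have hpos : ∀ i, 0 < N.inflow g w i := fun i => N.inflow_pos hg fun a _ => hC.trans_le (hw a)
  have node : ∀ i, i ≠ N.d →
      (∀ a, N.tgt a = i → w' a ≤ K (N.src a) * N.inflow g w (N.src a) * p a) →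
      N.inflow 0 w' i ≤ K i * N.inflow g w i := by
    intro i hi h
    have h1 : N.inflow 0 w' i ≤ ∑ a with N.tgt a = i, K i * w a := by
      rw [inflow_zero]
      refine Finset.sum_le_sum fun a ha => ?_
      have hai := (Finset.mem_filter.1 ha).2
      have hKa := hK _ (N.src_ne_d a)
      have h2 := hrate i hi a hai
      rw [div_mul_eq_mul_div, div_lt_iff₀ hC] at h2
      calc w' a ≤ K (N.src a) * N.inflow g w (N.src a) * p a := h a hai
        _ ≤ K (N.src a) * N.inflow g w (N.src a) :=
          mul_le_of_le_one_right (mul_pos hKa (hpos _)).le (hp1 a)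
        _ ≤ K (N.src a) * g := mul_le_mul_of_nonneg_left (hx a) hKa.le
        _ ≤ K i * C := by linarith
        _ ≤ K i * w a := mul_le_mul_of_nonneg_left (hw a) (hK i hi).le
    refine h1.trans ?_
    rw [← Finset.mul_sum]
    refine mul_le_mul_of_nonneg_left ?_ (hK i hi).le
    rw [inflow]
    split_ifs <;> linarith
  have arc : ∀ a, w' a ≤ K (N.src a) * N.inflow g w (N.src a) * p a := by
    intro a
    induction a using N.wellFounded_precedes.induction with
    | _ a ih =>
      have h := mul_le_mul_of_nonneg_right (node _ (N.src_ne_d a) ih) (hx0 a)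
      rw [hw']
      linarith
  exact fun a => node _ (N.src_ne_d a) fun b _ => arc b

variable [DecidableEq AO]

/-! ### Invariants of trajectories and flow bounds. -/

namespace IsTrajectory

variable {N : CoDAG I A AO} {s : AO → ℝ → ℝ} {β g : ℝ} {K : I → ℝ} {ξ w : ℝ → A → ℝ}

theorem selection_pos (h : N.IsTrajectory s β g K ξ w) (hK : ∀ i, i ≠ N.d → 0 < K i) {t : ℝ}
    (ht : 0 ≤ t) (a : A) : 0 < ξ t a := by
  have h1 := le_mul_exp_of_deriv_ge (k := K (N.src a)) (fun τ hτ => h.selection τ hτ a)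
    (fun τ _ => by
      have := mul_pos (hK _ (N.src_ne_d a)) (N.choiceProb_pos s β (w τ) a)
      linarith) ht
  exact pos_of_mul_pos_left ((h.init_pos a).trans_le h1) (Real.exp_pos _).le

theorem outflow_selection (h : N.IsTrajectory s β g K ξ w) (hg : 0 < g) {t : ℝ} (ht : 0 ≤ t)
    {i : I} (hi : i ≠ N.d) : N.outflow (ξ t) i = 1 := by
  have h0 : N.outflow (ξ 0) i = 1 :=
    N.outflow_eq_one_of_split hg (h.flow 0 le_rfl) h.init_pos h.init_feasible hi
  have hd : ∀ τ, 0 ≤ τ → HasDerivWithinAt (fun τ => N.outflow (ξ τ) i)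
      (K i * (1 - N.outflow (ξ τ) i)) (Set.Ici 0) τ := by
    intro τ hτ
    refine (HasDerivWithinAt.fun_sum fun a _ => h.selection τ hτ a).congr_deriv ?_
    rw [← N.outflow_choiceProb s β (w τ) hi, outflow, outflow, ← Finset.sum_sub_distrib,
      Finset.mul_sum]
    refine Finset.sum_congr rfl fun a ha => ?_
    rw [(Finset.mem_filter.1 ha).2]
    ring
  -- The total y satisfies y' = K (1 - y) and starts at 1; the Grönwall bound for both y - 1 and 1 -
  -- y pins it there.
  have h1 := le_mul_exp_of_deriv_ge (k := K i) (fun τ hτ => (hd τ hτ).sub_const 1)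
    (fun τ _ => by linarith) ht
  have h2 := le_mul_exp_of_deriv_ge (k := K i) (fun τ hτ => (hd τ hτ).const_sub 1)
    (fun τ _ => by linarith) ht
  rw [h0, sub_self] at h1 h2
  have := nonneg_of_mul_nonneg_left h1 (Real.exp_pos _)
  have := nonneg_of_mul_nonneg_left h2 (Real.exp_pos _)
  linarith

theorem flow_pos (h : N.IsTrajectory s β g K ξ w) (hK : ∀ i, i ≠ N.d → 0 < K i) (hg : 0 < g)
    {t : ℝ} (ht : 0 ≤ t) (a : A) : 0 < w t a :=
  N.pos_of_split hg (h.flow t ht) (h.selection_pos hK ht) a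

theorem feasible (h : N.IsTrajectory s β g K ξ w) (hK : ∀ i, i ≠ N.d → 0 < K i) (hg : 0 < g)
    {t : ℝ} (ht : 0 ≤ t) : w t ∈ N.feasible g :=
  N.feasible_of_split hg (h.flow t ht) (h.selection_pos hK ht)
    fun _ hi => h.outflow_selection hg ht hi

theorem ratio_eq (h : N.IsTrajectory s β g K ξ w) (hK : ∀ i, i ≠ N.d → 0 < K i) (hg : 0 < g)
    {t : ℝ} (ht : 0 ≤ t) (a : A) : w t a / N.outflow (w t) (N.src a) = ξ t a := by
  have hd := N.src_ne_d a
  rw [div_eq_iff (N.outflow_pos (h.flow_pos hK hg ht) hd).ne',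
    (N.mem_feasible_iff.1 (h.feasible hK hg ht)).1 _ hd, mul_comm]
  exact h.flow t ht a

/-- Differentiability of the flow is not part of the definition of a trajectory; it propagates arc
by arc from the origin by the product rule. -/
theorem exists_flow_deriv (h : N.IsTrajectory s β g K ξ w) {t : ℝ} (ht : 0 ≤ t) :
    ∃ w' : A → ℝ, (∀ a, HasDerivWithinAt (fun τ => w τ a) (w' a) (Set.Ici 0) t) ∧
      ∀ a, w' a = N.inflow 0 w' (N.src a) * ξ t a +
        N.inflow g (w t) (N.src a) * (K (N.src a) * (-ξ t a + N.choiceProb s β (w t) a)) := by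
  have hin : ∀ (w' : A → ℝ) (i : I), (∀ a, N.tgt a = i →
      HasDerivWithinAt (fun τ => w τ a) (w' a) (Set.Ici 0) t) →
      HasDerivWithinAt (fun τ => N.inflow g (w τ) i) (N.inflow 0 w' i) (Set.Ici 0) t := by
    intro w' i hw'
    rw [inflow_zero]
    exact (HasDerivWithinAt.fun_sum fun a ha => hw' a (Finset.mem_filter.1 ha).2).const_add _
  have hmul : ∀ (w' : A → ℝ) (a : A), (∀ b, N.tgt b = N.src a →
      HasDerivWithinAt (fun τ => w τ b) (w' b) (Set.Ici 0) t) →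
      HasDerivWithinAt (fun τ => w τ a) (N.inflow 0 w' (N.src a) * ξ t a +
        N.inflow g (w t) (N.src a) * (K (N.src a) * (-ξ t a + N.choiceProb s β (w t) a)))
        (Set.Ici 0) t := fun w' a hw' =>
    ((hin w' _ hw').mul (h.selection t ht a)).congr (fun τ hτ => h.flow τ hτ a) (h.flow t ht a)
  have hdiff : ∀ a, DifferentiableWithinAt ℝ (fun τ => w τ a) (Set.Ici 0) t := by
    intro a
    induction a using N.wellFounded_precedes.induction with
    | _ a ih => exact (hmul _ a fun b hb => (ih b hb).hasDerivWithinAt).differentiableWithinAt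
  refine ⟨fun a => derivWithin (fun τ => w τ a) (Set.Ici 0) t,
    fun a => (hdiff a).hasDerivWithinAt, fun a => ?_⟩
  exact (hmul _ a fun b _ => (hdiff b).hasDerivWithinAt).derivWithin
    (uniqueDiffOn_Ici 0 t ht)

/-- The selection relaxes towards a target that is always at least `c`, so it cannot cross `c`
downwards, whatever the rate. -/
theorem selection_ge (h : N.IsTrajectory s β g K ξ w) (hK : ∀ i, i ≠ N.d → 0 < K i) {c : ℝ}
    (hP : ∀ t, 0 ≤ t → ∀ a, c ≤ N.choiceProb s β (w t) a) (h0 : ∀ a, c ≤ ξ 0 a) {t : ℝ}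
    (ht : 0 ≤ t) (a : A) : c ≤ ξ t a := by
  have h1 := le_mul_exp_of_deriv_ge (k := K (N.src a))
    (fun τ hτ => (h.selection τ hτ a).sub_const c)
    (fun τ hτ => by
      have := mul_le_mul_of_nonneg_left (hP τ hτ a) (hK _ (N.src_ne_d a)).le
      linarith) ht
  exact sub_nonneg.1 (nonneg_of_mul_nonneg_left ((sub_nonneg.2 (h0 a)).trans h1) (Real.exp_pos _))

end IsTrajectory

theorem exists_isFlowBound (N : CoDAG I A AO) {s : AO → ℝ → ℝ}
    (hs : ∀ e, ContinuousOn (s e) (Set.Ici 0)) (β : ℝ) {g : ℝ} (hg : 0 < g) {S : Set (A → ℝ)}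
    {δ : ℝ} (hδ : 0 < δ) (hS : ∀ w ∈ S, ∀ a, δ ≤ w a) : ∃ C, N.IsFlowBound s β g S C := by
  obtain ⟨c, hc, hP⟩ := N.exists_choiceProb_lower_bound hs β hg
  -- `c` bounds the choice probabilities; `δ / g` bounds the initial splitting ratios, since no node
  -- flow exceeds `g`. Neither involves `K`.
  obtain ⟨C, hC, hbound⟩ := N.exists_lower_bound_of_split hg (lt_min hc (div_pos hδ hg))
  refine ⟨C, hC, fun K hK ξ w h hwS t ht a =>
    ⟨hbound _ _ (h.flow t ht) (fun b => h.selection_ge hK ?_ ?_ ht b) a,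
      N.le_demand (h.feasible hK hg ht) a⟩⟩
  · intro τ hτ b
    have hf := h.feasible hK hg hτ
    exact (min_le_left _ _).trans (hP _ ⟨hf.2.2, N.le_demand hf⟩ b)
  · intro b
    refine (min_le_right _ _).trans ?_
    have hpos := N.outflow_pos (h.flow_pos hK hg le_rfl) (N.src_ne_d b)
    rw [← h.ratio_eq hK hg le_rfl]
    exact div_le_div₀ (h.flow_pos hK hg le_rfl b).le (hS _ hwS b) hpos
      (N.outflow_le h.init_feasible (N.src_ne_d b))

/-! ### Lyapunov decay and its compactness consequences. -/

/-- The dissipation of the potential along the dynamics. -/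
noncomputable def dissipation (N : CoDAG I A AO) (s : AO → ℝ → ℝ) (β : ℝ) (K : I → ℝ)
    (w : A → ℝ) : ℝ :=
  1 / β * ∑ a, K (N.src a) * N.outflow w (N.src a) * (N.choiceProb s β w a *
    Real.log (N.choiceProb s β w a / (w a / N.outflow w (N.src a))))

theorem continuousOn_dissipation (N : CoDAG I A AO) {s : AO → ℝ → ℝ}
    (hs : ∀ e, ContinuousOn (s e) (Set.Ici 0)) (β : ℝ) (K : I → ℝ) :
    ContinuousOn (N.dissipation s β K) {w | ∀ a, 0 < w a} := by
  have hP : ∀ a, ContinuousOn (fun w => N.choiceProb s β w a) {w | ∀ a, 0 < w a} := fun a =>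
    (N.continuousOn_choiceProb hs β a).mono fun w hw b => (hw b).le
  refine continuousOn_const.mul (continuousOn_finsetSum _ fun a _ => ContinuousOn.mul ?_
    ((hP a).mul (((hP a).div (N.continuousOn_ratio a) fun w hw => (N.ratio_pos hw a).ne').log
      fun w hw => (div_pos (N.choiceProb_pos s β w a) (N.ratio_pos hw a)).ne')))
  unfold outflow
  fun_prop

theorem dissipation_nonneg (N : CoDAG I A AO) (s : AO → ℝ → ℝ) {β : ℝ} (hβ : 0 < β) {K : I → ℝ}
    (hK : ∀ i, i ≠ N.d → 0 < K i) {w : A → ℝ} (hw : ∀ a, 0 < w a) :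
    0 ≤ N.dissipation s β K w :=
  mul_nonneg (one_div_pos.2 hβ).le (N.sum_mul_log_div_nonneg (f := fun i => K i * N.outflow w i)
    (fun a => (mul_pos (hK _ (N.src_ne_d a)) (N.outflow_pos hw (N.src_ne_d a))).le)
    (N.choiceProb_pos s β w) (N.ratio_pos hw)
    fun i hi => by rw [N.outflow_ratio hw hi, N.outflow_choiceProb s β w hi])

theorem dissipation_pos (N : CoDAG I A AO) {s : AO → ℝ → ℝ} {β g : ℝ} (hβ : 0 < β) {K : I → ℝ}
    (hK : ∀ i, i ≠ N.d → 0 < K i) {w : A → ℝ} (hf : w ∈ N.feasible g) (hw : ∀ a, 0 < w a)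
    (hne : ¬ N.IsEquilibrium s β g w) : 0 < N.dissipation s β K w :=
  mul_pos (one_div_pos.2 hβ) (N.sum_mul_log_div_pos (f := fun i => K i * N.outflow w i)
    (fun a => mul_pos (hK _ (N.src_ne_d a)) (N.outflow_pos hw (N.src_ne_d a)))
    (N.choiceProb_pos s β w) (N.ratio_pos hw)
    (fun i hi => by rw [N.outflow_ratio hw hi, N.outflow_choiceProb s β w hi])
    fun h => hne ((N.isEquilibrium_iff_ratio hf hw).2 fun a => (congrFun h a).symm))

/-- The potential is a Lyapunov function of the dynamics. -/
theorem IsTrajectory.exists_potential_deriv {N : CoDAG I A AO} {s : AO → ℝ → ℝ}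
    (hs : ∀ e, ContinuousOn (s e) (Set.Ici 0)) {β g C : ℝ} {K : I → ℝ} {ξ w : ℝ → A → ℝ}
    (h : N.IsTrajectory s β g K ξ w) (hβ : 0 < β) (hg : 0 < g) (hC : 0 < C)
    (hK : ∀ i, i ≠ N.d → 0 < K i)
    (hrate : ∀ i, i ≠ N.d → ∀ a, N.tgt a = i → g / C * K (N.src a) < K i) {t : ℝ} (ht : 0 ≤ t)
    (hw : ∀ a, C ≤ w t a) :
    ∃ v, HasDerivWithinAt (fun τ => N.potential s β (w τ)) v (Set.Ici 0) t ∧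
      v ≤ -N.dissipation s β K (w t) := by
  obtain ⟨w', hd, hw'⟩ := h.exists_flow_deriv ht
  have hpos := h.flow_pos hK hg ht
  have hf := h.feasible hK hg ht
  have hξ := h.selection_pos hK ht
  have hP := N.choiceProb_pos s β (w t)
  have hx : ∀ a, N.inflow g (w t) (N.src a) = N.outflow (w t) (N.src a) := fun a =>
    ((N.mem_feasible_iff.1 hf).1 _ (N.src_ne_d a)).symm
  have hgrow := N.inflow_le_of_growth hC hg hK hrate hw
    (fun a => (hx a).trans_le (N.outflow_le hf (N.src_ne_d a)))
    (N.choiceProb_le_one s β (w t)) (fun a => (hξ a).le) hw'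
  have hout : ∀ i, i ≠ N.d → N.outflow w' i = N.inflow 0 w' i := by
    intro i hi
    have e1 : N.outflow w' i = ∑ a with N.src a = i, (N.inflow 0 w' i * ξ t a +
        N.inflow g (w t) i * (K i * (-ξ t a + N.choiceProb s β (w t) a))) := by
      refine Finset.sum_congr rfl fun a ha => ?_
      rw [hw', (Finset.mem_filter.1 ha).2]
    have e2 := h.outflow_selection hg ht hi
    have e3 := N.outflow_choiceProb s β (w t) hi
    rw [outflow] at e2 e3
    rw [e1, Finset.sum_add_distrib, ← Finset.mul_sum, ← Finset.mul_sum, ← Finset.mul_sum,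
      Finset.sum_add_distrib, Finset.sum_neg_distrib, e2, e3]
    ring
  refine ⟨_, N.hasDerivWithinAt_potential hs β hd hpos, ?_⟩
  rw [N.sum_mul_gradient s hβ hpos hout, dissipation, ← mul_neg]
  refine mul_le_mul_of_nonneg_left ?_ (one_div_pos.2 hβ).le
  -- The growth bound makes the weights K_i x_i - x'_i nonnegative; this Gibbs sum is exactly the
  -- gap between the derivative and minus the dissipation, up to the factor 1 / β.
  have hgibbs := N.sum_mul_log_div_nonneg
    (f := fun i => K i * N.inflow g (w t) i - N.inflow 0 w' i)
    (fun a => sub_nonneg.2 (hgrow a)) hξ hP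
    fun i hi => by rw [h.outflow_selection hg ht hi, N.outflow_choiceProb s β (w t) hi]
  rw [← sub_nonneg, ← Finset.sum_neg_distrib, ← Finset.sum_sub_distrib]
  refine hgibbs.trans (le_of_eq (Finset.sum_congr rfl fun a _ => ?_))
  have e1 : Real.log (N.choiceProb s β (w t) a / ξ t a) =
      -Real.log (ξ t a / N.choiceProb s β (w t) a) := by
    rw [← Real.log_inv, inv_div]
  rw [h.ratio_eq hK hg ht, e1, hw' a, hx a]
  ring

/-- For flows bounded below by `C`, small excess potential forces closeness to the equilibrium. -/
theorem IsEquilibrium.exists_potential_gap {N : CoDAG I A AO} {s : AO → ℝ → ℝ}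
    (hs_cont : ∀ e, ContinuousOn (s e) (Set.Ici 0)) (hs_mono : ∀ e, StrictMonoOn (s e) (Set.Ici 0))
    {β g C ε : ℝ} (hβ : 0 < β) (hg : 0 < g) (hC : 0 < C) {w : A → ℝ}
    (hw : N.IsEquilibrium s β g w) (hε : 0 < ε) :
    ∃ η > 0, ∀ v ∈ N.feasible g, (∀ a, C ≤ v a) →
      N.potential s β v < N.potential s β w + η → dist v w < ε := by
  let M : Set (A → ℝ) := N.feasible g ∩ ({v | ∀ a, C ≤ v a} ∩ {v | ε ≤ dist v w})
  have hpos : ∀ v ∈ M, ∀ a, 0 < v a := fun v hv a => hC.trans_le (hv.2.1 a)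
  have hM : IsCompact M := by
    refine (N.isCompact_feasible g).inter_right (IsClosed.inter ?_ ?_)
    · simp only [Set.ofPred_forall]
      exact isClosed_iInter fun a => isClosed_le continuous_const (continuous_apply a)
    · exact isClosed_le continuous_const (continuous_id.dist continuous_const)
  rcases M.eq_empty_or_nonempty with hem | hne
  · refine ⟨1, one_pos, fun v hv hvC _ => ?_⟩
    by_contra hd
    exact (hem ▸ (⟨hv, hvC, not_lt.1 hd⟩ : v ∈ M) : v ∈ (∅ : Set (A → ℝ)))
  · obtain ⟨u, hu, hmin⟩ := hM.exists_isMinOn hne ((N.continuousOn_potential hs_cont β).mono hpos)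
    have huw : u ≠ w := by
      rintro rfl
      have := hu.2.2
      rw [Set.mem_ofPred_eq, dist_self] at this
      linarith
    have hlt := hw.potential_lt hs_cont hs_mono hβ hg hu.1 (hpos u hu) huw
    refine ⟨_, sub_pos.2 hlt, fun v hv hvC hvη => ?_⟩
    by_contra hd
    have : N.potential s β u ≤ N.potential s β v :=
      hmin (⟨hv, hvC, not_lt.1 hd⟩ : v ∈ M)
    linarith

/-- Dissipation vanishes only at the equilibrium, which the condition on the potential excludes, so
it has a positive minimum on the remaining compact set. -/
theorem IsEquilibrium.exists_dissipation_gap {N : CoDAG I A AO} {s : AO → ℝ → ℝ}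
    (hs : ∀ e, ContinuousOn (s e) (Set.Ici 0)) {β g C η : ℝ} (hβ : 0 < β) (hC : 0 < C)
    {K : I → ℝ} (hK : ∀ i, i ≠ N.d → 0 < K i) {w : A → ℝ}
    (huniq : ∀ v, N.IsEquilibrium s β g v → v = w) (hη : 0 < η) :
    ∃ m > 0, ∀ v ∈ N.feasible g, (∀ a, C ≤ v a) →
      N.potential s β w + η ≤ N.potential s β v → m ≤ N.dissipation s β K v := by
  let M₀ : Set (A → ℝ) := N.feasible g ∩ {v | ∀ a, C ≤ v a}
  have hpos : ∀ v ∈ M₀, ∀ a, 0 < v a := fun v hv a => hC.trans_le (hv.2 a)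
  have hM₀ : IsCompact M₀ := by
    refine (N.isCompact_feasible g).inter_right ?_
    simp only [Set.ofPred_forall]
    exact isClosed_iInter fun a => isClosed_le continuous_const (continuous_apply a)
  let M : Set (A → ℝ) := M₀ ∩ N.potential s β ⁻¹' Set.Ici (N.potential s β w + η)
  have hM : IsCompact M := hM₀.of_isClosed_subset
    (((N.continuousOn_potential hs β).mono hpos).preimage_isClosed_of_isClosed hM₀.isClosed
      isClosed_Ici) Set.inter_subset_left
  rcases M.eq_empty_or_nonempty with hem | hne
  · refine ⟨1, one_pos, fun v hv hvC hvη => ?_⟩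
    exact ((hem ▸ (⟨⟨hv, hvC⟩, hvη⟩ : v ∈ M) : v ∈ (∅ : Set (A → ℝ)))).elim
  · obtain ⟨u, hu, hmin⟩ := hM.exists_isMinOn hne
      ((N.continuousOn_dissipation hs β K).mono fun v hv => hpos v hv.1)
    refine ⟨_, N.dissipation_pos hβ hK hu.1.1 (hpos u hu.1) fun he => ?_,
      fun v hv hvC hvη => hmin (⟨⟨hv, hvC⟩, hvη⟩ : v ∈ M)⟩
    have h1 : N.potential s β w + η ≤ N.potential s β u := hu.2
    rw [huniq u he] at h1
    linarith

theorem IsTrajectory.exists_potential_lt {N : CoDAG I A AO} {s : AO → ℝ → ℝ}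
    (hs : ∀ e, ContinuousOn (s e) (Set.Ici 0)) {β g C : ℝ} {K : I → ℝ} {ξ w : ℝ → A → ℝ}
    (h : N.IsTrajectory s β g K ξ w) (hβ : 0 < β) (hg : 0 < g) (hC : 0 < C)
    (hK : ∀ i, i ≠ N.d → 0 < K i)
    (hrate : ∀ i, i ≠ N.d → ∀ a, N.tgt a = i → g / C * K (N.src a) < K i)
    (hw : ∀ t, 0 ≤ t → ∀ a, C ≤ w t a) {c m : ℝ} (hm : 0 < m)
    (hgap : ∀ v ∈ N.feasible g, (∀ a, C ≤ v a) → c ≤ N.potential s β v →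
      m ≤ N.dissipation s β K v) :
    ∃ t, 0 ≤ t ∧ N.potential s β (w t) < c := by
  by_contra! hcon
  choose! v hv hvle using fun t (ht : 0 ≤ t) => h.exists_potential_deriv hs hβ hg hC hK hrate ht
    (hw t ht)
  have hd : ∀ t, 0 ≤ t → HasDerivWithinAt (fun τ => -N.potential s β (w τ) - m * τ)
      (-v t - m) (Set.Ici 0) t := fun t ht =>
    ((hv t ht).neg.sub ((hasDerivWithinAt_id t (Set.Ici 0)).const_mul m)).congr_deriv (by ring)
  have hmono := monotoneOn_Ici_of_deriv_nonneg hd fun t ht => by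
    have := hgap _ (h.feasible hK hg ht) (hw t ht) (hcon t ht)
    have := hvle t ht
    linarith
  -- Decay at rate `m` from time 0 would bring the potential down to `c - m` by time `T`.
  set T : ℝ := (N.potential s β (w 0) - c) / m + 1 with hT
  have hT0 : 0 ≤ T := add_nonneg (div_nonneg (sub_nonneg.2 (hcon 0 le_rfl)) hm.le) zero_le_one
  have h1 := hmono (Set.mem_Ici.2 le_rfl) (Set.mem_Ici.2 hT0) hT0
  have h2 := hcon T hT0
  have h3 : m * T = N.potential s β (w 0) - c + m := by rw [hT]; field_simp
  simp only at h1
  linarith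

theorem IsTrajectory.potential_antitone {N : CoDAG I A AO} {s : AO → ℝ → ℝ}
    (hs : ∀ e, ContinuousOn (s e) (Set.Ici 0)) {β g C : ℝ} {K : I → ℝ} {ξ w : ℝ → A → ℝ}
    (h : N.IsTrajectory s β g K ξ w) (hβ : 0 < β) (hg : 0 < g) (hC : 0 < C)
    (hK : ∀ i, i ≠ N.d → 0 < K i)
    (hrate : ∀ i, i ≠ N.d → ∀ a, N.tgt a = i → g / C * K (N.src a) < K i)
    (hw : ∀ t, 0 ≤ t → ∀ a, C ≤ w t a) {t₁ t₂ : ℝ} (h1 : 0 ≤ t₁) (h12 : t₁ ≤ t₂) :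
    N.potential s β (w t₂) ≤ N.potential s β (w t₁) := by
  choose! v hv hvle using fun t (ht : 0 ≤ t) => h.exists_potential_deriv hs hβ hg hC hK hrate ht
    (hw t ht)
  have hmono := monotoneOn_Ici_of_deriv_nonneg (fun t ht => (hv t ht).fun_neg) fun t ht => by
    have := N.dissipation_nonneg s hβ hK (h.flow_pos hK hg ht)
    have := hvle t ht
    linarith
  exact neg_le_neg_iff.1 (hmono (Set.mem_Ici.2 h1) (Set.mem_Ici.2 (h1.trans h12)) h12)

end CoDAG

/-! ### Assembly of the theorem. -/

theorem mainTheorem3 {I A AO : Type*} [Fintype A] [DecidableEq I] [DecidableEq AO]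
    (N : CoDAG I A AO) (s : AO → ℝ → ℝ)
    (hs_cont : ∀ e, ContinuousOn (s e) (Set.Ici 0))
    (hs_mono : ∀ e, StrictMonoOn (s e) (Set.Ici 0))
    (hs_nonneg : ∀ e, ∀ x, 0 ≤ x → 0 ≤ s e x)
    (β g : ℝ) (hβ : 0 < β) (hg : 0 < g) :
    ∃ wbar : A → ℝ,
      -- `wbar` is the unique equilibrium
      N.IsEquilibrium s β g wbar ∧ (∀ w, N.IsEquilibrium s β g w → w = wbar) ∧
      -- flow bounds exist, independently of the update rates
      (∀ S : Set (A → ℝ), (∃ δ > 0, ∀ w ∈ S, ∀ a, δ ≤ w a) → ∃ C, N.IsFlowBound s β g S C) ∧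
      -- global asymptotic convergence: attraction and Lyapunov stability
      (∀ (S : Set (A → ℝ)) (C : ℝ), N.IsFlowBound s β g S C →
        ∀ K : I → ℝ, (∀ i, i ≠ N.d → 0 < K i) →
        (∀ i, i ≠ N.d → ∀ a, N.tgt a = i → g / C * K (N.src a) < K i) →
        (∀ ξ w : ℝ → A → ℝ, N.IsTrajectory s β g K ξ w → w 0 ∈ S →
          Tendsto w atTop (𝓝 wbar)) ∧
        (∀ ε > 0, ∃ δ > 0, ∀ ξ w : ℝ → A → ℝ, N.IsTrajectory s β g K ξ w → w 0 ∈ S →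
          dist (w 0) wbar < δ → ∀ t, 0 ≤ t → dist (w t) wbar < ε)) := by
  obtain ⟨wbar, hbar⟩ := N.exists_isEquilibrium hs_cont hβ hg
  have huniq : ∀ w, N.IsEquilibrium s β g w → w = wbar := by
    intro w hw
    by_contra hne
    exact lt_asymm (hbar.potential_lt hs_cont hs_mono hβ hg hw.1 (hw.pos hg) hne)
      (hw.potential_lt hs_cont hs_mono hβ hg hbar.1 (hbar.pos hg) (Ne.symm hne))
  refine ⟨wbar, hbar, huniq, fun S ⟨δ, hδ, hS⟩ => N.exists_isFlowBound hs_cont β hg hδ hS, ?_⟩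
  rintro S C ⟨hC, hbound⟩ K hK hrate
  have hlow : ∀ ξ w, N.IsTrajectory s β g K ξ w → w 0 ∈ S → ∀ t, 0 ≤ t → ∀ a, C ≤ w t a :=
    fun ξ w h hS t ht a => (hbound K hK ξ w h hS t ht a).1
  constructor
  · intro ξ w h hS
    have hw := hlow ξ w h hS
    rw [Metric.tendsto_atTop]
    intro ε hε
    obtain ⟨η, hη, hclose⟩ := hbar.exists_potential_gap hs_cont hs_mono hβ hg hC hε
    obtain ⟨m, hm, hgap⟩ := CoDAG.IsEquilibrium.exists_dissipation_gap hs_cont hβ hC hK huniq hη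
    obtain ⟨T, hT, hlt⟩ := h.exists_potential_lt hs_cont hβ hg hC hK hrate hw hm hgap
    refine ⟨T, fun t ht => hclose _ (h.feasible hK hg (hT.trans ht)) (hw t (hT.trans ht)) ?_⟩
    -- Once below the level, the potential stays there, so closeness persists after `T`.
    exact (h.potential_antitone hs_cont hβ hg hC hK hrate hw hT ht).trans_lt hlt
  · intro ε hε
    obtain ⟨η, hη, hclose⟩ := hbar.exists_potential_gap hs_cont hs_mono hβ hg hC hε
    have hopen : IsOpen {w : A → ℝ | ∀ a, 0 < w a} := by
      simp only [Set.ofPred_forall]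
      exact isOpen_iInter_of_finite fun a => isOpen_lt continuous_const (continuous_apply a)
    -- The equilibrium is an interior point of the positive orthant, so a small initial distance
    -- means small excess potential, which monotonicity preserves for all time.
    have hcont := (N.continuousOn_potential hs_cont β).continuousAt
      (hopen.mem_nhds (hbar.pos hg))
    obtain ⟨δ, hδ, hnear⟩ := Metric.eventually_nhds_iff.1
      (hcont.eventually_lt_const (lt_add_of_pos_right _ hη))
    refine ⟨δ, hδ, fun ξ w h hS hd t ht => ?_⟩
    have hw := hlow ξ w h hS
    exact hclose _ (h.feasible hK hg ht) (hw t ht)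
      ((h.potential_antitone hs_cont hβ hg hC hK hrate hw le_rfl ht).trans_lt (hnear hd))
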